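/- \textbf{Theorem.} A surface is a smooth immersion $X:U\to\mathbb R^4$ of a nonempty open set $U\subset\mathbb R^2$, with the induced metric and Levi-Civita connection $\nabla$. It has constant principal angles $\theta_1\le\theta_2$ with respect to a two-dimensional subspace $\Pi\subset\mathbb R^4$ if, for every $p\in U$, the tangent plane $T_p=dX_p(\mathbb R^2)$ and $\Pi$ have principal angles $\theta_1,\theta_2$. In that case $T_1$ and $T_2$ denote smooth unit tangent fields, defined on an open subset of $U$, with $S_pT_i=\cos^2(\theta_i)\,T_i$, where $S_p$ is the symmetric endomorphism of $T_p$ with $\langle S_pv,v'\rangle=\langle \mathrm{pr}_\Pi v,\mathrm{pr}_\Pi v'\rangle$; $T_i$ is geodesic if $\nabla_{T_i}T_i=0$ on its domain. The first normal space at $p$ is the span of the values of the second fundamental form at $p$. The surface is a composition (in the sense of Dajczer and do Carmo) if $X=F\circ g$ with $g:U\to W\subset\mathbb R^3$ smooth and isometric for the metric induced by $X$, $W$ open, and $F:W\to\mathbb R^4$ a smooth isometric immersion for the Euclidean metric of $W$. (1) For all $0<\theta_1<\theta_2<\frac{\pi}{2}$ there exist a two-dimensional subspace $\Pi\subset\mathbb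 R^4$ and an (embedded) surface $X:U\to\mathbb R^4$ with constant principal angles $\theta_1,\theta_2$ with respect to $\Pi$ whose first normal space has dimension $2$ at every point. (2) Let $0<\theta_1<\theta_2<\frac{\pi}{2}$ and let $X:U\to\mathbb R^4$ be any surface with constant principal angles $\theta_1,\theta_2$ with respect to a two-dimensional subspace $\Pi$ whose first normal space has dimension $2$ at every point. Then fields $T_1$ and $T_2$ exist in a neighbourhood of every point of $U$; on no nonempty open subset of $U$ is such a field $T_1$ or such a field $T_2$ geodesic; and the restriction of $X$ to a nonempty open subset of $U$ is never a composition. In particular, there exist surfaces in $\mathbb R^4$ with constant principal angles $0<\theta_1<\theta_2<\frac{\pi}{2}$ that are not compositions. -/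

import Mathlib

open scoped ContDiff RealInnerProductSpace

noncomputable section

/-- A parametrized immersed (smooth) surface `X : U → ℝ⁴`, `U ⊆ ℝ²` open and nonempty. -/
structure IsImmersedSurface (U : Set (EuclideanSpace ℝ (Fin 2)))
    (X : EuclideanSpace ℝ (Fin 2) → EuclideanSpace ℝ (Fin 4)) : Prop where
  isOpen : IsOpen U
  nonempty : U.Nonempty
  smooth : ContDiffOn ℝ ∞ X U
  immersion : ∀ p ∈ U, Function.Injective (fderiv ℝ X p)

/-- The tangent plane of the surface `X` at the parameter `p`, as a linear subspace of `ℝ⁴`. -/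
def tangentPlane (X : EuclideanSpace ℝ (Fin 2) → EuclideanSpace ℝ (Fin 4))
    (p : EuclideanSpace ℝ (Fin 2)) : Submodule ℝ (EuclideanSpace ℝ (Fin 4)) :=
  LinearMap.range (fderiv ℝ X p : EuclideanSpace ℝ (Fin 2) →ₗ[ℝ] EuclideanSpace ℝ (Fin 4))

/-- `0 ≤ θ₁ ≤ θ₂ ≤ π / 2` are the principal angles between the planes `V` and `W`:
`cos θ₁ = ⟪v₁, w₁⟫` is the maximum of `⟪v, w⟫` over unit vectors `v ∈ V`, `w ∈ W`, and `cos θ₂` is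
the maximum over those that are in addition orthogonal to `v₁` and `w₁` respectively. -/
def IsPrincipalAngles (V W : Submodule ℝ (EuclideanSpace ℝ (Fin 4))) (θ₁ θ₂ : ℝ) : Prop :=
  0 ≤ θ₁ ∧ θ₁ ≤ θ₂ ∧ θ₂ ≤ Real.pi / 2 ∧
    ∃ v₁ ∈ V, ∃ w₁ ∈ W, ‖v₁‖ = 1 ∧ ‖w₁‖ = 1 ∧ ⟪v₁, w₁⟫ = Real.cos θ₁ ∧
      IsGreatest {c : ℝ | ∃ v ∈ V, ∃ w ∈ W, ‖v‖ = 1 ∧ ‖w‖ = 1 ∧ ⟪v, w⟫ = c} (Real.cos θ₁) ∧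
      IsGreatest {c : ℝ | ∃ v ∈ V, ∃ w ∈ W, ‖v‖ = 1 ∧ ‖w‖ = 1 ∧ ⟪v, v₁⟫ = 0 ∧ ⟪w, w₁⟫ = 0 ∧
        ⟪v, w⟫ = c} (Real.cos θ₂)

/-- The surface `X : U → ℝ⁴` has constant principal angles `θ₁ ≤ θ₂` with respect to the
plane `P`. -/
def HasConstantPrincipalAngles (U : Set (EuclideanSpace ℝ (Fin 2)))
    (X : EuclideanSpace ℝ (Fin 2) → EuclideanSpace ℝ (Fin 4))
    (P : Submodule ℝ (EuclideanSpace ℝ (Fin 4))) (θ₁ θ₂ : ℝ) : Prop :=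
  Module.finrank ℝ P = 2 ∧ ∀ p ∈ U, IsPrincipalAngles (tangentPlane X p) P θ₁ θ₂

/-- The second fundamental form `α(dX a, dX b)`: the normal component of `D²X (a, b)`. -/
def secondFundamentalForm (X : EuclideanSpace ℝ (Fin 2) → EuclideanSpace ℝ (Fin 4))
    (p a b : EuclideanSpace ℝ (Fin 2)) : EuclideanSpace ℝ (Fin 4) :=
  (tangentPlane X p)ᗮ.starProjection (fderiv ℝ (fderiv ℝ X) p a b)

/-- The first normal space at `p`: the span of the values of the second fundamental form. -/
def firstNormalSpace (X : EuclideanSpace ℝ (Fin 2) → EuclideanSpace ℝ (Fin 4))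
    (p : EuclideanSpace ℝ (Fin 2)) : Submodule ℝ (EuclideanSpace ℝ (Fin 4)) :=
  Submodule.span ℝ {n | ∃ a b, n = secondFundamentalForm X p a b}

/-- The symmetric endomorphism of `V` that represents the quadratic form `v ↦ |p_W v|²`,
where `p_W` is the orthogonal projection onto `W`. -/
def angleOperator (W V : Submodule ℝ (EuclideanSpace ℝ (Fin 4))) : Module.End ℝ V :=
  (V.orthogonalProjectionOnto ∘L W.starProjection ∘L V.subtypeL : V →L[ℝ] V).toLinearMap

theorem inner_angleOperator (W V : Submodule ℝ (EuclideanSpace ℝ (Fin 4))) (v v' : V) :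
    ⟪angleOperator W V v, v'⟫ =
      ⟪W.starProjection (v : EuclideanSpace ℝ (Fin 4)), W.starProjection v'⟫ := by
  have h : ⟪angleOperator W V v, v'⟫ =
      ⟪W.starProjection (v : EuclideanSpace ℝ (Fin 4)), (v' : EuclideanSpace ℝ (Fin 4))⟫ := by
    simp [angleOperator]
  rw [h, Submodule.inner_starProjection_left_eq_right,
    Submodule.inner_starProjection_left_eq_right,
    Submodule.starProjection_eq_self_iff.2 (W.starProjection_apply_mem _)]

/-- `T` is a smooth unit tangent field of the surface `X` over `V` (a principal direction field)
that consists of eigenvectors of the operator `angleOperator P` for the eigenvalue `cos² θ`. -/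
def IsPrincipalField (V : Set (EuclideanSpace ℝ (Fin 2)))
    (X : EuclideanSpace ℝ (Fin 2) → EuclideanSpace ℝ (Fin 4))
    (P : Submodule ℝ (EuclideanSpace ℝ (Fin 4))) (θ : ℝ)
    (T : EuclideanSpace ℝ (Fin 2) → EuclideanSpace ℝ (Fin 4)) : Prop :=
  ContDiffOn ℝ ∞ T V ∧ ∀ p ∈ V, ‖T p‖ = 1 ∧ ∃ h : T p ∈ tangentPlane X p,
    (angleOperator P (tangentPlane X p)).HasEigenvector (Real.cos θ ^ 2) ⟨T p, h⟩

/-- The Levi-Civita derivative of the tangent field `T` in the direction `dX a` at `p`: the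
tangential component of the derivative in `ℝ⁴`. -/
def covariantDerivative (X T : EuclideanSpace ℝ (Fin 2) → EuclideanSpace ℝ (Fin 4))
    (p a : EuclideanSpace ℝ (Fin 2)) : EuclideanSpace ℝ (Fin 4) :=
  (tangentPlane X p).starProjection (fderiv ℝ T p a)

/-- The tangent field `T` is geodesic over `V`: `∇_T T = 0`. -/
def IsGeodesicField (V : Set (EuclideanSpace ℝ (Fin 2)))
    (X T : EuclideanSpace ℝ (Fin 2) → EuclideanSpace ℝ (Fin 4)) : Prop :=
  ∀ p ∈ V, ∀ a, fderiv ℝ X p a = T p → covariantDerivative X T p a = 0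

/-- The surface `X : U → ℝ⁴` is a composition in the sense of Dajczer and do Carmo: `X = F ∘ g`
with `g : U → W` isometric for the metric induced by `X` on `U` and the Euclidean metric of
the open set `W ⊆ ℝ³`, and `F : W → ℝ⁴` an isometric immersion. -/
def IsComposition (U : Set (EuclideanSpace ℝ (Fin 2)))
    (X : EuclideanSpace ℝ (Fin 2) → EuclideanSpace ℝ (Fin 4)) : Prop :=
  ∃ (W : Set (EuclideanSpace ℝ (Fin 3)))
    (g : EuclideanSpace ℝ (Fin 2) → EuclideanSpace ℝ (Fin 3))
    (F : EuclideanSpace ℝ (Fin 3) → EuclideanSpace ℝ (Fin 4)),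
    IsOpen W ∧ ContDiffOn ℝ ∞ g U ∧ Set.MapsTo g U W ∧
    (∀ p ∈ U, ∀ a b, ⟪fderiv ℝ g p a, fderiv ℝ g p b⟫ = ⟪fderiv ℝ X p a, fderiv ℝ X p b⟫) ∧
    ContDiffOn ℝ ∞ F W ∧
    (∀ q ∈ W, ∀ a b, ⟪fderiv ℝ F q a, fderiv ℝ F q b⟫ = ⟪a, b⟫) ∧
    Set.EqOn X (F ∘ g) U

end

/-!
Let `X` have constant principal angles with unit principal fields `T₀`, `T₁`, and write
`Tᵢ = cos θᵢ eᵢ + sin θᵢ nᵢ` with `eᵢ` in the plane and `nᵢ` orthogonal to it. The conormals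
`Nᵢ = -sin θᵢ eᵢ + cos θᵢ nᵢ` span the normal planes. The two rotation forms `⟪de₀, e₁⟫` and
`⟪dn₀, n₁⟫` determine the second fundamental form `α`, whose symmetry forces `α(T₀, T₁) = 0` and
`⟪dnᵢ(tᵢ), nⱼ⟫ = tan θᵢ cot θⱼ ⟪deᵢ(tᵢ), eⱼ⟫`, where `dX(tᵢ) = Tᵢ`. Hence everything is a multiple
of `Γᵢ = ⟪deᵢ(tᵢ), eⱼ⟫`: for `θ₀ ≠ θ₁` both `α(Tᵢ, Tᵢ) ∈ ℝ Nⱼ` and `∇_{Tᵢ} Tᵢ` vanish exactly where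
`Γᵢ` does, and the first normal space is two-dimensional exactly where `Γ₀` and `Γ₁` are nonzero.

If `X = F ∘ g`, the Gauss equation of the flat hypersurface `F` says that the unit normal `η` of `F`
satisfies `⟪α(T₀, T₀), η⟫ ⟪α(T₁, T₁), η⟫ = ⟪α(T₀, T₁), η⟫² = 0`, so `η` is one of the `±Nᵢ`, the
same one near each point. Since `⟪α(Tᵢ, Tᵢ), Nᵢ⟫ = 0`, the direction `g_* Tᵢ` is a null direction
of the hypersurface, so `η` is parallel along `Tᵢ`; but `⟪dNᵢ(tᵢ), Nⱼ⟫` is a nonzero multiple of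
`Γᵢ`.

An example is a pair of exponential spirals in `ℂ × ℂ = ℝ⁴`, for which `Γ₀` and `Γ₁` have no zeros.
-/

noncomputable section

section Projections

variable {E : Type*} [NormedAddCommGroup E] [InnerProductSpace ℝ E] {K : Submodule ℝ E}

theorem inner_starProjection_left_of_mem [K.HasOrthogonalProjection] (x : E) {y : E} (hy : y ∈ K) :
    ⟪K.starProjection x, y⟫ = ⟪x, y⟫ := by
  rw [K.inner_starProjection_left_eq_right, K.starProjection_eq_self_iff.2 hy]

variable (K) in
theorem inner_starProjection_starProjection [K.HasOrthogonalProjection] (x y : E) :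
    ⟪K.starProjection x, K.starProjection y⟫ = ⟪K.starProjection x, y⟫ := by
  rw [real_inner_comm, real_inner_comm y,
    inner_starProjection_left_of_mem _ (K.starProjection_apply_mem x)]

variable (K) in
theorem inner_eq_inner_starProjection_add [K.HasOrthogonalProjection] (x y : E) :
    ⟪x, y⟫ = ⟪K.starProjection x, K.starProjection y⟫ +
      ⟪Kᗮ.starProjection x, Kᗮ.starProjection y⟫ := by
  rw [inner_starProjection_starProjection, inner_starProjection_starProjection, ← inner_add_left,
    K.starProjection_add_starProjection_orthogonal]

theorem starProjection_eq_sum_inner_smul [FiniteDimensional ℝ K] {ι : Type*} [Fintype ι]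
    {v : ι → E} (hv : Orthonormal ℝ v) (hmem : ∀ i, v i ∈ K)
    (hcard : Fintype.card ι = Module.finrank ℝ K) (x : E) :
    K.starProjection x = ∑ i, ⟪v i, x⟫ • v i := by
  have hvK : Orthonormal ℝ fun i => (⟨v i, hmem i⟩ : K) := hv.codRestrict K hmem
  let b : OrthonormalBasis ι ℝ K :=
    OrthonormalBasis.mk hvK (hvK.linearIndependent.span_eq_top_of_card_eq_finrank' hcard).ge
  simpa [b] using DFunLike.congr_fun b.starProjection_eq_sum_rankOne x

theorem eq_sum_inner_smul_of_mem [FiniteDimensional ℝ K] {ι : Type*} [Fintype ι]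
    {v : ι → E} (hv : Orthonormal ℝ v) (hmem : ∀ i, v i ∈ K)
    (hcard : Fintype.card ι = Module.finrank ℝ K) {x : E} (hx : x ∈ K) :
    x = ∑ i, ⟪v i, x⟫ • v i :=
  (K.starProjection_eq_self_iff.2 hx).symm.trans (starProjection_eq_sum_inner_smul hv hmem hcard x)

theorem starProjection_eq_inner_smul_of_forall_inner_le [K.HasOrthogonalProjection] {u w : E}
    (hw : w ∈ K) (hw1 : ‖w‖ = 1) (hmax : ∀ z ∈ K, ‖z‖ = 1 → ⟪u, z⟫ ≤ ⟪u, w⟫) :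
    K.starProjection u = ⟪u, w⟫ • w := by
  set x := K.starProjection u
  have hxK : x ∈ K := K.starProjection_apply_mem u
  have hinner {z : E} (hz : z ∈ K) : ⟪u, z⟫ = ⟪x, z⟫ := (inner_starProjection_left_of_mem u hz).symm
  have hnorm : ‖x‖ ≤ ⟪x, w⟫ := by
    rcases eq_or_ne x 0 with h0 | h0
    · simp [h0]
    · have := hmax (‖x‖⁻¹ • x) (K.smul_mem _ hxK) (norm_smul_inv_norm (𝕜 := ℝ) h0)
      rwa [hinner hw, hinner (K.smul_mem _ hxK), real_inner_smul_right,
        real_inner_self_eq_norm_mul_norm, inv_mul_cancel_left₀ (norm_ne_zero_iff.2 h0)] at this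
  have hCS : ⟪x, w⟫ = ‖x‖ * ‖w‖ :=
    (real_inner_le_norm x w).antisymm (by rwa [hw1, mul_one])
  have := inner_eq_norm_mul_iff_real.1 hCS
  rwa [hw1, one_smul, ← mul_one ‖x‖, ← hw1, ← hCS, ← hinner hw] at this

end Projections

section PrincipalFamily

variable {E : Type*} [NormedAddCommGroup E] [InnerProductSpace ℝ E] {P : Submodule ℝ E}
  [P.HasOrthogonalProjection] {ι : Type*} {θ : ι → ℝ} {v : ι → E} {i j : ι}

/-- `v` is an orthonormal family of principal directions relative to `P`: the vector `v i` makes the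
angle `θ i` with `P`, and the projections of the `v i` to `P` are pairwise orthogonal. -/
structure IsPrincipalFamily (P : Submodule ℝ E) [P.HasOrthogonalProjection] (θ : ι → ℝ)
    (v : ι → E) : Prop where
  orthonormal : Orthonormal ℝ v
  inner_starProjection_self (i : ι) :
    ⟪P.starProjection (v i), P.starProjection (v i)⟫ = Real.cos (θ i) ^ 2
  inner_starProjection_of_ne {i j : ι} (hij : i ≠ j) :
    ⟪P.starProjection (v i), P.starProjection (v j)⟫ = 0

/-- The operator that turns a unit vector `v = cos θ e + sin θ n`, with unit vectors `e ∈ P` and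
`n ∈ Pᗮ`, into the unit vector `-sin θ e + cos θ n` orthogonal to it. -/
def conormal (P : Submodule ℝ E) [P.HasOrthogonalProjection] (θ : ℝ) : E →L[ℝ] E :=
  Real.cot θ • Pᗮ.starProjection - Real.tan θ • P.starProjection

theorem inner_conormal_right (P : Submodule ℝ E) [P.HasOrthogonalProjection] (θ : ℝ) (x y : E) :
    ⟪x, conormal P θ y⟫ = Real.cot θ * ⟪Pᗮ.starProjection x, Pᗮ.starProjection y⟫ -
      Real.tan θ * ⟪P.starProjection x, P.starProjection y⟫ := by
  rw [inner_starProjection_starProjection, inner_starProjection_starProjection,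
    P.inner_starProjection_left_eq_right, Pᗮ.inner_starProjection_left_eq_right]
  simp [conormal, inner_sub_right, real_inner_smul_right]

theorem inner_conormal_conormal (P : Submodule ℝ E) [P.HasOrthogonalProjection] (θ θ' : ℝ)
    (x y : E) :
    ⟪conormal P θ x, conormal P θ' y⟫ =
      Real.cot θ * Real.cot θ' * ⟪Pᗮ.starProjection x, Pᗮ.starProjection y⟫ +
        Real.tan θ * Real.tan θ' * ⟪P.starProjection x, P.starProjection y⟫ := by
  have hPP : P.starProjection (P.starProjection x) = P.starProjection x :=
    P.starProjection_eq_self_iff.2 (P.starProjection_apply_mem x)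
  have hP : P.starProjection (conormal P θ x) = -Real.tan θ • P.starProjection x := by
    simp [conormal, hPP]
  have hPperp : Pᗮ.starProjection (conormal P θ x) = Real.cot θ • Pᗮ.starProjection x := by
    simp [conormal, hPP]
  rw [inner_conormal_right, hP, hPperp, real_inner_smul_left, real_inner_smul_left]
  ring

namespace IsPrincipalFamily

variable (hv : IsPrincipalFamily P θ v)
include hv

theorem inner_self (i : ι) : ⟪v i, v i⟫ = 1 := by
  rw [real_inner_self_eq_norm_sq, hv.orthonormal.norm_eq_one, one_pow]

theorem inner_starProjection_orthogonal_self (i : ι) :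
    ⟪Pᗮ.starProjection (v i), Pᗮ.starProjection (v i)⟫ = Real.sin (θ i) ^ 2 := by
  have := inner_eq_inner_starProjection_add P (v i) (v i)
  rw [hv.inner_self, hv.inner_starProjection_self] at this
  linarith [Real.sin_sq_add_cos_sq (θ i)]

theorem inner_starProjection_orthogonal_of_ne (hij : i ≠ j) :
    ⟪Pᗮ.starProjection (v i), Pᗮ.starProjection (v j)⟫ = 0 := by
  have := inner_eq_inner_starProjection_add P (v i) (v j)
  rw [hv.orthonormal.inner_eq_zero hij, hv.inner_starProjection_of_ne hij] at this
  linarith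

theorem inner_conormal (hθ : Real.tan (θ i) ≠ 0) (j : ι) :
    ⟪v j, conormal P (θ i) (v i)⟫ = 0 := by
  rw [inner_conormal_right]
  rcases eq_or_ne j i with rfl | hji
  · rw [hv.inner_starProjection_orthogonal_self, hv.inner_starProjection_self]
    have ⟨_, _⟩ := div_ne_zero_iff.1 (Real.tan_eq_sin_div_cos (θ j) ▸ hθ)
    rw [Real.tan_eq_sin_div_cos, Real.cot_eq_cos_div_sin]
    field_simp
    ring
  · rw [hv.inner_starProjection_orthogonal_of_ne hji, hv.inner_starProjection_of_ne hji]
    ring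

theorem orthonormal_conormal (hθ : ∀ i, Real.tan (θ i) ≠ 0) :
    Orthonormal ℝ fun i => conormal P (θ i) (v i) := by
  refine ⟨fun i => ?_, fun i j hij => ?_⟩
  · rw [← pow_eq_one_iff_of_nonneg (norm_nonneg _) two_ne_zero, ← real_inner_self_eq_norm_sq,
      inner_conormal_conormal, hv.inner_starProjection_orthogonal_self,
      hv.inner_starProjection_self]
    obtain ⟨hsin, hcos⟩ := div_ne_zero_iff.1 (Real.tan_eq_sin_div_cos (θ i) ▸ hθ i)
    rw [Real.tan_eq_sin_div_cos, Real.cot_eq_cos_div_sin]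
    field_simp
    exact Real.cos_sq_add_sin_sq (θ i)
  · change ⟪conormal P (θ i) (v i), conormal P (θ j) (v j)⟫ = 0
    rw [inner_conormal_conormal, hv.inner_starProjection_orthogonal_of_ne hij,
      hv.inner_starProjection_of_ne hij]
    ring

theorem starProjection_starProjection [Fintype ι] {K : Submodule ℝ E} [FiniteDimensional ℝ K]
    (hmem : ∀ i, v i ∈ K) (hcard : Fintype.card ι = Module.finrank ℝ K) (i : ι) :
    K.starProjection (P.starProjection (v i)) = Real.cos (θ i) ^ 2 • v i := by
  rw [starProjection_eq_sum_inner_smul hv.orthonormal hmem hcard, Finset.sum_eq_single i]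
  · rw [real_inner_comm, ← inner_starProjection_starProjection, hv.inner_starProjection_self]
  · intro j _ hji
    rw [real_inner_comm, ← inner_starProjection_starProjection,
      hv.inner_starProjection_of_ne hji.symm, zero_smul]
  · simp

theorem orthonormal_inv_cos_smul_starProjection (hcos : ∀ i, Real.cos (θ i) ≠ 0) :
    Orthonormal ℝ fun i => (Real.cos (θ i))⁻¹ • P.starProjection (v i) := by
  refine ⟨fun i => ?_, fun i j hij => ?_⟩
  · rw [← pow_eq_one_iff_of_nonneg (norm_nonneg _) two_ne_zero, ← real_inner_self_eq_norm_sq,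
      real_inner_smul_left, real_inner_smul_right, hv.inner_starProjection_self]
    field_simp [hcos i]
  · change ⟪(Real.cos (θ i))⁻¹ • P.starProjection (v i),
      (Real.cos (θ j))⁻¹ • P.starProjection (v j)⟫ = 0
    rw [real_inner_smul_left, real_inner_smul_right, hv.inner_starProjection_of_ne hij, mul_zero,
      mul_zero]

theorem starProjection_starProjection_starProjection_eq_sum [Fintype ι] {K : Submodule ℝ E}
    [FiniteDimensional ℝ K] (hmem : ∀ i, v i ∈ K) (hcard : Fintype.card ι = Module.finrank ℝ K)
    (x : E) :
    K.starProjection (P.starProjection (K.starProjection x)) =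
      ∑ i, (Real.cos (θ i) ^ 2 * ⟪v i, x⟫) • v i := by
  rw [starProjection_eq_sum_inner_smul hv.orthonormal hmem hcard x, map_sum, map_sum]
  refine Finset.sum_congr rfl fun i _ => ?_
  rw [map_smul, map_smul, hv.starProjection_starProjection hmem hcard, smul_smul, mul_comm]

theorem starProjection_starProjection_starProjection_sub_smul [Fintype ι] {K : Submodule ℝ E}
    [FiniteDimensional ℝ K] (hmem : ∀ i, v i ∈ K) (hcard : Fintype.card ι = Module.finrank ℝ K)
    (hij : ∀ k, k = i ∨ k = j) (x : E) :
    K.starProjection (P.starProjection (K.starProjection x)) -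
        Real.cos (θ j) ^ 2 • K.starProjection x =
      ((Real.cos (θ i) ^ 2 - Real.cos (θ j) ^ 2) * ⟪v i, x⟫) • v i := by
  rw [hv.starProjection_starProjection_starProjection_eq_sum hmem hcard,
    starProjection_eq_sum_inner_smul hv.orthonormal hmem hcard, Finset.smul_sum,
    ← Finset.sum_sub_distrib, Finset.sum_eq_single i ?_ (by simp)]
  · module
  · intro k _ hki
    rw [(hij k).resolve_left hki]
    module

end IsPrincipalFamily

theorem IsPrincipalFamily.of_starProjection_starProjection {K : Submodule ℝ E}
    [K.HasOrthogonalProjection] (hmem : ∀ i, v i ∈ K) (hunit : ∀ i, ‖v i‖ = 1)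
    (heig : ∀ i, K.starProjection (P.starProjection (v i)) = Real.cos (θ i) ^ 2 • v i)
    (hinj : Function.Injective fun i => Real.cos (θ i) ^ 2) : IsPrincipalFamily P θ v := by
  have hinner (i j : ι) :
      ⟪P.starProjection (v i), P.starProjection (v j)⟫ = Real.cos (θ i) ^ 2 * ⟪v i, v j⟫ := by
    rw [inner_starProjection_starProjection, ← inner_starProjection_left_of_mem _ (hmem j), heig,
      real_inner_smul_left]
  have horth {i j : ι} (hij : i ≠ j) : ⟪v i, v j⟫ = 0 := by
    have hij' := hinner i j
    rw [real_inner_comm, hinner, real_inner_comm (v i)] at hij'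
    by_contra hne
    exact hij.symm (hinj (mul_right_cancel₀ hne hij'))
  refine ⟨⟨hunit, fun i j hij => horth hij⟩, fun i => ?_, fun {i j} hij => ?_⟩
  · rw [hinner, real_inner_self_eq_norm_sq, hunit, one_pow, mul_one]
  · rw [hinner, horth hij, mul_zero]

end PrincipalFamily

section PrincipalAngles
namespace IsPrincipalFamily

variable {E : Type*} [NormedAddCommGroup E] [InnerProductSpace ℝ E] {K P : Submodule ℝ E}
  [FiniteDimensional ℝ K] [P.HasOrthogonalProjection] {ι : Type*} [Fintype ι] {θ : ι → ℝ}
  {v : ι → E}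

theorem inner_starProjection_eq_sum (hv : IsPrincipalFamily P θ v) (hmem : ∀ i, v i ∈ K)
    (hcard : Fintype.card ι = Module.finrank ℝ K) {x : E} (hx : x ∈ K) :
    ⟪P.starProjection x, P.starProjection x⟫ = ∑ i, Real.cos (θ i) ^ 2 * ⟪v i, x⟫ ^ 2 := by
  have hcoord (i : ι) : ⟪P.starProjection x, v i⟫ = Real.cos (θ i) ^ 2 * ⟪v i, x⟫ := by
    rw [P.inner_starProjection_left_eq_right, real_inner_comm,
      ← inner_starProjection_left_of_mem _ hx, hv.starProjection_starProjection hmem hcard,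
      real_inner_smul_left]
  calc ⟪P.starProjection x, P.starProjection x⟫
      = ⟪P.starProjection x, ∑ i, ⟪v i, x⟫ • v i⟫ := by
        rw [inner_starProjection_starProjection,
          ← eq_sum_inner_smul_of_mem hv.orthonormal hmem hcard hx]
    _ = ∑ i, Real.cos (θ i) ^ 2 * ⟪v i, x⟫ ^ 2 := by
        rw [inner_sum]
        refine Finset.sum_congr rfl fun i _ => ?_
        rw [real_inner_smul_right, hcoord]
        ring

theorem norm_starProjection_le (hv : IsPrincipalFamily P θ v) (hmem : ∀ i, v i ∈ K)
    (hcard : Fintype.card ι = Module.finrank ℝ K) {x : E} (hx : x ∈ K) {c : ℝ} (hc0 : 0 ≤ c)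
    (hc : ∀ i, ⟪v i, x⟫ ≠ 0 → |Real.cos (θ i)| ≤ c) : ‖P.starProjection x‖ ≤ c * ‖x‖ := by
  have hterm (i : ι) : Real.cos (θ i) ^ 2 * ⟪v i, x⟫ ^ 2 ≤ c ^ 2 * ⟪v i, x⟫ ^ 2 := by
    rcases eq_or_ne ⟪v i, x⟫ 0 with h0 | h0
    · simp [h0]
    · exact mul_le_mul_of_nonneg_right (sq_le_sq' (abs_le.1 (hc i h0)).1 (abs_le.1 (hc i h0)).2)
        (sq_nonneg _)
  refine le_of_sq_le_sq ?_ (by positivity)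
  calc ‖P.starProjection x‖ ^ 2 = ∑ i, Real.cos (θ i) ^ 2 * ⟪v i, x⟫ ^ 2 := by
        rw [← real_inner_self_eq_norm_sq, hv.inner_starProjection_eq_sum hmem hcard hx]
    _ ≤ ∑ i, c ^ 2 * ⟪v i, x⟫ ^ 2 := Finset.sum_le_sum fun i _ => hterm i
    _ = c ^ 2 * ⟪∑ i, ⟪v i, x⟫ • v i, x⟫ := by
        rw [← Finset.mul_sum, sum_inner]
        simp only [real_inner_smul_left, sq]
    _ = (c * ‖x‖) ^ 2 := by
        rw [← eq_sum_inner_smul_of_mem hv.orthonormal hmem hcard hx, real_inner_self_eq_norm_sq,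
          mul_pow]

end IsPrincipalFamily

variable {V W : Submodule ℝ (EuclideanSpace ℝ (Fin 4))}

theorem IsPrincipalAngles.exists_isPrincipalFamily {θ : Fin 2 → ℝ}
    (h : IsPrincipalAngles V W (θ 0) (θ 1)) (hW : Module.finrank ℝ W = 2) :
    ∃ v : Fin 2 → EuclideanSpace ℝ (Fin 4), IsPrincipalFamily W θ v ∧ ∀ i, v i ∈ V := by
  obtain ⟨-, -, -, v₁, hv₁, w₁, hw₁, nv₁, nw₁, hvw₁, hmax₁, hmax₂⟩ := h
  obtain ⟨⟨v₂, hv₂, w₂, hw₂, nv₂, nw₂, ov, ow, hvw₂⟩, -⟩ := hmax₂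
  have hWv₁ : W.starProjection v₁ = Real.cos (θ 0) • w₁ := by
    rw [← hvw₁]
    refine starProjection_eq_inner_smul_of_forall_inner_le hw₁ nw₁ fun z hz nz => ?_
    exact (hmax₁.2 ⟨v₁, hv₁, z, hz, nv₁, nz, rfl⟩).trans_eq hvw₁.symm
  have hVw₁ : V.starProjection w₁ = Real.cos (θ 0) • v₁ := by
    rw [← hvw₁, real_inner_comm]
    refine starProjection_eq_inner_smul_of_forall_inner_le hv₁ nv₁ fun z hz nz => ?_
    rw [real_inner_comm, real_inner_comm v₁]
    exact (hmax₁.2 ⟨z, hz, w₁, hw₁, nz, nw₁, rfl⟩).trans_eq hvw₁.symm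
  have hv₂w₁ : ⟪w₁, v₂⟫ = 0 := by
    rw [← inner_starProjection_left_of_mem w₁ hv₂, hVw₁, real_inner_smul_left, real_inner_comm, ov,
      mul_zero]
  have hw : Orthonormal ℝ ![w₁, w₂] := by
    simp [nw₁, nw₂, real_inner_comm w₂, ow]
  have hWv₂ : W.starProjection v₂ = Real.cos (θ 1) • w₂ := by
    rw [starProjection_eq_sum_inner_smul hw (Fin.forall_fin_two.2 ⟨hw₁, hw₂⟩) (by simp [hW])]
    simp [hv₂w₁, real_inner_comm, hvw₂]
  refine ⟨![v₁, v₂], ⟨?_, ?_, ?_⟩, Fin.forall_fin_two.2 ⟨hv₁, hv₂⟩⟩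
  · simp [nv₁, nv₂, real_inner_comm v₂, ov]
  · simp [Fin.forall_fin_two, hWv₁, hWv₂, norm_smul, nw₁, nw₂]
  · simp [Fin.forall_fin_two, hWv₁, hWv₂, real_inner_smul_left, real_inner_smul_right, ow,
      real_inner_comm w₂]

theorem IsPrincipalFamily.isPrincipalAngles {θ : Fin 2 → ℝ}
    {v : Fin 2 → EuclideanSpace ℝ (Fin 4)} (hv : IsPrincipalFamily W θ v) (hmem : ∀ i, v i ∈ V)
    (hV : Module.finrank ℝ V = 2) (h0 : 0 ≤ θ 0) (h01 : θ 0 ≤ θ 1) (hpi : θ 1 < Real.pi / 2) :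
    IsPrincipalAngles V W (θ 0) (θ 1) := by
  have hcard : Fintype.card (Fin 2) = Module.finrank ℝ V := by simp [hV]
  have hcos (i : Fin 2) : 0 < Real.cos (θ i) := by
    revert i
    refine Fin.forall_fin_two.2 ⟨?_, ?_⟩
    all_goals exact Real.cos_pos_of_mem_Ioo ⟨by linarith, by linarith⟩
  have hcos_le : Real.cos (θ 1) ≤ Real.cos (θ 0) :=
    Real.cos_le_cos_of_nonneg_of_le_pi h0 (by linarith) h01
  let w (i : Fin 2) := (Real.cos (θ i))⁻¹ • W.starProjection (v i)
  have hw (i : Fin 2) : w i ∈ W := W.smul_mem _ (W.starProjection_apply_mem _)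
  have hw_orthonormal : Orthonormal ℝ w :=
    hv.orthonormal_inv_cos_smul_starProjection fun i => (hcos i).ne'
  have hvw (i : Fin 2) : ⟪v i, w i⟫ = Real.cos (θ i) := by
    rw [real_inner_smul_right, real_inner_comm, ← inner_starProjection_starProjection,
      hv.inner_starProjection_self, sq, inv_mul_cancel_left₀ (hcos i).ne']
  have hbound {x y : EuclideanSpace ℝ (Fin 4)} (hy : y ∈ W) (nx : ‖x‖ = 1) (ny : ‖y‖ = 1) {c : ℝ}
      (hc : ‖W.starProjection x‖ ≤ c * ‖x‖) : ⟪x, y⟫ ≤ c := by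
    rw [← inner_starProjection_left_of_mem x hy]
    simpa [nx, ny] using (real_inner_le_norm _ y).trans (mul_le_mul_of_nonneg_right hc (by simp))
  have nv := hv.orthonormal.norm_eq_one
  have nw := hw_orthonormal.norm_eq_one
  refine ⟨h0, h01, hpi.le, v 0, hmem 0, w 0, hw 0, nv 0, nw 0, hvw 0,
    ⟨⟨v 0, hmem 0, w 0, hw 0, nv 0, nw 0, hvw 0⟩, ?_⟩,
    ⟨v 1, hmem 1, w 1, hw 1, nv 1, nw 1, hv.orthonormal.inner_eq_zero one_ne_zero,
      hw_orthonormal.inner_eq_zero one_ne_zero, hvw 1⟩, ?_⟩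
  · rintro _ ⟨x, hx, y, hy, nx, ny, rfl⟩
    refine hbound hy nx ny (hv.norm_starProjection_le hmem hcard hx (hcos 0).le ?_)
    simp [Fin.forall_fin_two, abs_of_pos (hcos _), hcos_le]
  · rintro _ ⟨x, hx, y, hy, nx, ny, hx0, -, rfl⟩
    refine hbound hy nx ny (hv.norm_starProjection_le hmem hcard hx (hcos 1).le ?_)
    simp [Fin.forall_fin_two, abs_of_pos (hcos _), real_inner_comm, hx0]

end PrincipalAngles

section Calculus

open Filter Topology

variable {G F E : Type*} [NormedAddCommGroup G] [NormedSpace ℝ G]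
  [NormedAddCommGroup F] [NormedSpace ℝ F] [NormedAddCommGroup E] [InnerProductSpace ℝ E]

theorem fderiv_fderiv_comm_of_contDiffAt {f : G → F} {p : G} (hf : ContDiffAt ℝ ∞ f p) (a b : G) :
    fderiv ℝ (fderiv ℝ f) p a b = fderiv ℝ (fderiv ℝ f) p b a :=
  hf.isSymmSndFDerivAt
    (by rw [minSmoothness_of_isRCLikeNormedField]; exact WithTop.coe_le_coe.2 le_top) a b

theorem hasFDerivAt_fderiv_apply {f : G → F} {p : G} (hf : ContDiffAt ℝ ∞ f p) (b : G) :
    HasFDerivAt (fun q => fderiv ℝ f q b) ((fderiv ℝ (fderiv ℝ f) p).flip b) p := by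
  have hf' : ContDiffAt ℝ ∞ (fderiv ℝ f) p := hf.fderiv_right (by simp)
  exact ((hf'.differentiableAt (by simp)).hasFDerivAt.clm_apply
    (hasFDerivAt_const b p)).congr_fderiv (by ext; simp)

theorem inner_add_inner_eq_zero_of_eventually_inner_eq {f g : G → E} {f' g' : G →L[ℝ] E} {p : G}
    (hf : HasFDerivAt f f' p) (hg : HasFDerivAt g g' p) {c : ℝ}
    (h : ∀ᶠ q in 𝓝 p, ⟪f q, g q⟫ = c) (a : G) : ⟪f p, g' a⟫ + ⟪f' a, g p⟫ = 0 := by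
  have hconst : HasFDerivAt (fun q => ⟪f q, g q⟫) (0 : G →L[ℝ] ℝ) p :=
    (hasFDerivAt_const c p).congr_of_eventuallyEq h
  simpa using DFunLike.congr_fun ((hf.inner ℝ hg).unique hconst) a

theorem inner_fderiv_fderiv_add_inner_fderiv_eq_zero {f N : G → E} {N' : G →L[ℝ] E} {p : G}
    (hf : ContDiffAt ℝ ∞ f p) (hN : HasFDerivAt N N' p) {b : G}
    (h : ∀ᶠ q in 𝓝 p, ⟪fderiv ℝ f q b, N q⟫ = 0) (a : G) :
    ⟪fderiv ℝ (fderiv ℝ f) p a b, N p⟫ + ⟪fderiv ℝ f p b, N' a⟫ = 0 := by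
  rw [add_comm]
  exact inner_add_inner_eq_zero_of_eventually_inner_eq (hasFDerivAt_fderiv_apply hf b) hN h a

end Calculus

section SmoothProjection

variable {G H E : Type*} [NormedAddCommGroup G] [NormedSpace ℝ G]
  [NormedAddCommGroup H] [InnerProductSpace ℝ H] [FiniteDimensional ℝ H]
  [NormedAddCommGroup E] [InnerProductSpace ℝ E] [CompleteSpace E]

theorem isInvertible_adjoint_comp_self [CompleteSpace H] {L : H →L[ℝ] E}
    (hL : Function.Injective L) : (L.adjoint ∘L L).IsInvertible := by
  have hinj : Function.Injective ((L.adjoint ∘L L : H →L[ℝ] H) : H →ₗ[ℝ] H) := by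
    refine (injective_iff_map_eq_zero _).2 fun a ha => ?_
    have hLa : ⟪L a, L a⟫ = 0 := by
      rw [← L.adjoint_inner_right, show L.adjoint (L a) = 0 from ha, inner_zero_right]
    exact (map_eq_zero_iff L hL).1 (inner_self_eq_zero.1 hLa)
  exact ⟨(LinearEquiv.ofInjectiveEndo _ hinj).toContinuousLinearEquiv, by ext; rfl⟩

theorem starProjection_range_eq [CompleteSpace H] {L : H →L[ℝ] E} (hL : Function.Injective L) :
    (LinearMap.range (L : H →ₗ[ℝ] E)).starProjection =
      L ∘L (L.adjoint ∘L L).inverse ∘L L.adjoint := by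
  ext y
  refine Submodule.eq_starProjection_of_mem_of_inner_eq_zero ⟨_, rfl⟩ ?_
  rintro _ ⟨a, rfl⟩
  have hsolve := (isInvertible_adjoint_comp_self hL).self_apply_inverse (L.adjoint y)
  simp only [ContinuousLinearMap.comp_apply] at hsolve
  change ⟪y - L ((L.adjoint ∘L L).inverse (L.adjoint y)), L a⟫ = 0
  rw [← L.adjoint_inner_left, map_sub, hsolve, sub_self, inner_zero_left]

theorem contDiffOn_starProjection_range {n : WithTop ℕ∞} {L : G → H →L[ℝ] E} {s : Set G}
    (hL : ContDiffOn ℝ n L s) (hinj : ∀ p ∈ s, Function.Injective (L p)) :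
    ContDiffOn ℝ n (fun p => (LinearMap.range (L p : H →ₗ[ℝ] E)).starProjection) s := by
  have := FiniteDimensional.complete ℝ H
  have hadj : ContDiffOn ℝ n (fun p => (L p).adjoint) s := by
    have : IsBoundedLinearMap ℝ (fun A : H →L[ℝ] E => A.adjoint) :=
      IsLinearMap.with_bound ⟨map_add _, fun c A => by simp⟩ 1 (by simp)
    exact this.contDiff.comp_contDiffOn hL
  have hinv : ContDiffOn ℝ n (fun p => ((L p).adjoint ∘L L p).inverse) s := fun p hp =>
    (isInvertible_adjoint_comp_self (hinj p hp)).contDiffAt_map_inverse.comp_contDiffWithinAt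
      (f := fun p => (L p).adjoint ∘L L p) p ((hadj.clm_comp hL) p hp)
  exact (hL.clm_comp (hinv.clm_comp hadj)).congr fun p hp => starProjection_range_eq (hinj p hp)

end SmoothProjection

section PrincipalFrame

open Filter Topology

variable {G E : Type*} [NormedAddCommGroup G] [NormedSpace ℝ G] [NormedAddCommGroup E]
  [InnerProductSpace ℝ E] {ι : Type*}

/-- The part along `K` of the connection form `a ↦ ⟪dTᵢ(a), Tⱼ⟫` of the fields `T` at `p`. For
orthonormal fields the parts along `K` and `Kᗮ` add up to the connection form. -/
def connectionForm (K : Submodule ℝ E) [K.HasOrthogonalProjection] (T : ι → G → E) (i j : ι)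
    (p a : G) : ℝ :=
  ⟪K.starProjection (fderiv ℝ (T i) p a), K.starProjection (T j p)⟫

theorem connectionForm_antisymm {K : Submodule ℝ E} [K.HasOrthogonalProjection] {T : ι → G → E}
    {i j : ι} {p : G} (hi : DifferentiableAt ℝ (T i) p) (hj : DifferentiableAt ℝ (T j) p) {c : ℝ}
    (h : ∀ᶠ q in 𝓝 p, ⟪K.starProjection (T i q), K.starProjection (T j q)⟫ = c) (a : G) :
    connectionForm K T i j p a = -connectionForm K T j i p a := by
  have := inner_add_inner_eq_zero_of_eventually_inner_eq
    (K.starProjection.hasFDerivAt.comp p hi.hasFDerivAt)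
    (K.starProjection.hasFDerivAt.comp p hj.hasFDerivAt) h a
  rw [real_inner_comm] at this
  exact eq_neg_of_add_eq_zero_right this

/-- `T` is a smooth frame of principal directions with constant angles `θ` relative to `P` along the
immersion `X : V → E`. -/
structure IsPrincipalFrame [Fintype ι] (V : Set G) (X : G → E) (P : Submodule ℝ E)
    [P.HasOrthogonalProjection] (θ : ι → ℝ) (T : ι → G → E) : Prop where
  card_eq_finrank : Fintype.card ι = Module.finrank ℝ G
  isOpen : IsOpen V
  contDiffOn : ContDiffOn ℝ ∞ X V
  contDiffOn_field (i : ι) : ContDiffOn ℝ ∞ (T i) V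
  mem_range {p : G} (hp : p ∈ V) (i : ι) : T i p ∈ LinearMap.range (fderiv ℝ X p : G →ₗ[ℝ] E)
  isPrincipalFamily {p : G} (hp : p ∈ V) : IsPrincipalFamily P θ fun i => T i p

namespace IsPrincipalFrame

variable [Fintype ι] {V : Set G} {X : G → E} {P : Submodule ℝ E} [P.HasOrthogonalProjection]
  {θ : ι → ℝ} {T : ι → G → E} (h : IsPrincipalFrame V X P θ T) {p t : G} (hp : p ∈ V) {i j : ι}
include h hp

theorem eventually_mem : ∀ᶠ q in 𝓝 p, q ∈ V := h.isOpen.mem_nhds hp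

theorem contDiffAt : ContDiffAt ℝ ∞ X p := h.contDiffOn.contDiffAt (h.isOpen.mem_nhds hp)

theorem hasFDerivAt_field (i : ι) : HasFDerivAt (T i) (fderiv ℝ (T i) p) p :=
  (((h.contDiffOn_field i).contDiffAt (h.isOpen.mem_nhds hp)).differentiableAt
    (by simp)).hasFDerivAt

theorem connectionForm_antisymm (i j : ι) (a : G) :
    connectionForm P T i j p a = -connectionForm P T j i p a := by
  classical
  refine _root_.connectionForm_antisymm (c := if i = j then Real.cos (θ i) ^ 2 else 0)
    (h.hasFDerivAt_field hp i).differentiableAt (h.hasFDerivAt_field hp j).differentiableAt ?_ a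
  filter_upwards [h.eventually_mem hp] with q hq
  split_ifs with hij
  · exact hij ▸ (h.isPrincipalFamily hq).inner_starProjection_self i
  · exact (h.isPrincipalFamily hq).inner_starProjection_of_ne hij

theorem connectionForm_orthogonal_antisymm (i j : ι) (a : G) :
    connectionForm Pᗮ T i j p a = -connectionForm Pᗮ T j i p a := by
  classical
  refine _root_.connectionForm_antisymm (c := if i = j then Real.sin (θ i) ^ 2 else 0)
    (h.hasFDerivAt_field hp i).differentiableAt (h.hasFDerivAt_field hp j).differentiableAt ?_ a
  filter_upwards [h.eventually_mem hp] with q hq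
  split_ifs with hij
  · exact hij ▸ (h.isPrincipalFamily hq).inner_starProjection_orthogonal_self i
  · exact (h.isPrincipalFamily hq).inner_starProjection_orthogonal_of_ne hij

section FiniteDimensional

variable [FiniteDimensional ℝ G]

theorem finrank_range :
    Module.finrank ℝ (LinearMap.range (fderiv ℝ X p : G →ₗ[ℝ] E)) = Fintype.card ι := by
  refine le_antisymm (h.card_eq_finrank ▸ LinearMap.finrank_range_le _) ?_
  exact ((h.isPrincipalFamily hp).orthonormal.codRestrict _
    (h.mem_range hp)).linearIndependent.fintype_card_le_finrank

theorem injective_fderiv : Function.Injective (fderiv ℝ X p) := by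
  refine LinearMap.ker_eq_bot.1 (Submodule.finrank_eq_zero.1 ?_)
  have := LinearMap.finrank_range_add_finrank_ker (fderiv ℝ X p : G →ₗ[ℝ] E)
  rw [h.finrank_range hp, h.card_eq_finrank] at this
  omega

theorem fderiv_eq_sum (a : G) : fderiv ℝ X p a = ∑ i, ⟪T i p, fderiv ℝ X p a⟫ • T i p :=
  eq_sum_inner_smul_of_mem (h.isPrincipalFamily hp).orthonormal (h.mem_range hp)
    (h.finrank_range hp).symm ⟨a, rfl⟩

theorem inner_fderiv_conormal (hj : Real.tan (θ j) ≠ 0) (a : G) :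
    ⟪fderiv ℝ X p a, conormal P (θ j) (T j p)⟫ = 0 := by
  rw [h.fderiv_eq_sum hp, sum_inner]
  refine Finset.sum_eq_zero fun i _ => ?_
  rw [real_inner_smul_left, (h.isPrincipalFamily hp).inner_conormal hj i, mul_zero]

theorem inner_fderiv_fderiv_conormal (hj : Real.tan (θ j) ≠ 0) (ht : fderiv ℝ X p t = T i p)
    (a : G) :
    ⟪fderiv ℝ (fderiv ℝ X) p a t, conormal P (θ j) (T j p)⟫ =
      Real.cot (θ j) * connectionForm Pᗮ T i j p a -
        Real.tan (θ j) * connectionForm P T i j p a := by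
  have hN : HasFDerivAt (fun q => conormal P (θ j) (T j q))
      (conormal P (θ j) ∘L fderiv ℝ (T j) p) p :=
    (conormal P (θ j)).hasFDerivAt.comp p (h.hasFDerivAt_field hp j)
  have hX := inner_fderiv_fderiv_add_inner_fderiv_eq_zero (h.contDiffAt hp) hN (b := t)
    ((h.eventually_mem hp).mono fun q hq => h.inner_fderiv_conormal hq hj t) a
  have hT := inner_add_inner_eq_zero_of_eventually_inner_eq (h.hasFDerivAt_field hp i) hN
    ((h.eventually_mem hp).mono fun q hq => (h.isPrincipalFamily hq).inner_conormal hj i) a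
  rw [ht] at hX
  rw [connectionForm, connectionForm, ← inner_conormal_right]
  linarith

theorem inner_fderiv_fderiv_conormal_self (hi : Real.tan (θ i) ≠ 0) (ht : fderiv ℝ X p t = T i p)
    (a : G) : ⟪fderiv ℝ (fderiv ℝ X) p a t, conormal P (θ i) (T i p)⟫ = 0 := by
  rw [h.inner_fderiv_fderiv_conormal hp hi ht,
    self_eq_neg.1 (h.connectionForm_orthogonal_antisymm hp i i a),
    self_eq_neg.1 (h.connectionForm_antisymm hp i i a)]
  ring

theorem connectionForm_orthogonal_eq (hi : Real.tan (θ i) ≠ 0) (ht : fderiv ℝ X p t = T i p)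
    (j : ι) :
    connectionForm Pᗮ T i j p t = Real.tan (θ i) ^ 2 * connectionForm P T i j p t := by
  obtain ⟨s, hs⟩ : ∃ s, fderiv ℝ X p s = T j p := h.mem_range hp j
  have hsymm := h.inner_fderiv_fderiv_conormal_self hp hi ht s
  rw [fderiv_fderiv_comm_of_contDiffAt (h.contDiffAt hp),
    h.inner_fderiv_fderiv_conormal hp hi hs, ← Real.tan_inv_eq_cot] at hsymm
  rw [h.connectionForm_antisymm hp, h.connectionForm_orthogonal_antisymm hp]
  field_simp at hsymm
  linarith

theorem inner_fderiv_fderiv_self_conormal (hθ : ∀ i, Real.tan (θ i) ≠ 0)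
    (ht : fderiv ℝ X p t = T i p) (j : ι) :
    ⟪fderiv ℝ (fderiv ℝ X) p t t, conormal P (θ j) (T j p)⟫ =
      Real.cot (θ j) * (Real.tan (θ i) ^ 2 - Real.tan (θ j) ^ 2) *
        connectionForm P T i j p t := by
  rw [h.inner_fderiv_fderiv_conormal hp (hθ j) ht, h.connectionForm_orthogonal_eq hp (hθ i) ht,
    ← Real.tan_inv_eq_cot]
  field_simp [hθ j]

theorem inner_fderiv_field (hi : Real.tan (θ i) ≠ 0) (ht : fderiv ℝ X p t = T i p) (j : ι) :
    ⟪fderiv ℝ (T i) p t, T j p⟫ = (1 + Real.tan (θ i) ^ 2) * connectionForm P T i j p t := by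
  rw [inner_eq_inner_starProjection_add P, one_add_mul, ← h.connectionForm_orthogonal_eq hp hi ht]
  rfl

theorem inner_conormal_fderiv_conormal (hi : Real.tan (θ i) ≠ 0) (ht : fderiv ℝ X p t = T i p)
    (j : ι) :
    ⟪conormal P (θ i) (fderiv ℝ (T i) p t), conormal P (θ j) (T j p)⟫ =
      Real.tan (θ i) * (Real.tan (θ j) + Real.cot (θ j)) * connectionForm P T i j p t := by
  have hβ := h.connectionForm_orthogonal_eq hp hi ht j
  rw [connectionForm, connectionForm] at hβ
  rw [inner_conormal_conormal, hβ, connectionForm, ← Real.tan_inv_eq_cot (θ i)]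
  field_simp
  ring

end FiniteDimensional

end IsPrincipalFrame

end PrincipalFrame

section FirstNormalSpace

namespace IsPrincipalFrame

variable {V : Set (EuclideanSpace ℝ (Fin 2))}
  {X : EuclideanSpace ℝ (Fin 2) → EuclideanSpace ℝ (Fin 4)}
  {P : Submodule ℝ (EuclideanSpace ℝ (Fin 4))} {θ : Fin 2 → ℝ}
  {T : Fin 2 → EuclideanSpace ℝ (Fin 2) → EuclideanSpace ℝ (Fin 4)}
  (h : IsPrincipalFrame V X P θ T) (hθ : ∀ i, Real.tan (θ i) ≠ 0)
  {p : EuclideanSpace ℝ (Fin 2)} (hp : p ∈ V)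
include h hθ hp

theorem conormal_mem_orthogonal (j : Fin 2) :
    conormal P (θ j) (T j p) ∈ (tangentPlane X p)ᗮ := by
  rintro _ ⟨a, rfl⟩
  exact h.inner_fderiv_conormal hp (hθ j) a

theorem starProjection_orthogonal_tangentPlane_eq_sum (x : EuclideanSpace ℝ (Fin 4)) :
    (tangentPlane X p)ᗮ.starProjection x =
      ∑ j, ⟪conormal P (θ j) (T j p), x⟫ • conormal P (θ j) (T j p) := by
  have hadd := (tangentPlane X p).finrank_add_finrank_orthogonal
  have htangent : Module.finrank ℝ (tangentPlane X p) = 2 := h.finrank_range hp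
  rw [htangent, finrank_euclideanSpace_fin] at hadd
  refine starProjection_eq_sum_inner_smul ((h.isPrincipalFamily hp).orthonormal_conormal hθ)
    (h.conormal_mem_orthogonal hθ hp) ?_ x
  rw [Fintype.card_fin]
  omega

theorem secondFundamentalForm_eq_sum (a b : EuclideanSpace ℝ (Fin 2)) :
    secondFundamentalForm X p a b =
      ∑ j, ⟪fderiv ℝ (fderiv ℝ X) p a b, conormal P (θ j) (T j p)⟫ • conormal P (θ j) (T j p) := by
  simp only [← real_inner_comm (fderiv ℝ (fderiv ℝ X) p a b)]
  exact h.starProjection_orthogonal_tangentPlane_eq_sum hθ hp _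

variable {t : Fin 2 → EuclideanSpace ℝ (Fin 2)} (ht : ∀ i, fderiv ℝ X p (t i) = T i p)
include ht

theorem secondFundamentalForm_of_ne {i j : Fin 2} (hij : i ≠ j) :
    secondFundamentalForm X p (t i) (t j) = 0 := by
  rw [h.secondFundamentalForm_eq_sum hθ hp]
  refine Finset.sum_eq_zero fun k _ => ?_
  obtain rfl | rfl : k = i ∨ k = j := by omega
  · rw [fderiv_fderiv_comm_of_contDiffAt (h.contDiffAt hp),
      h.inner_fderiv_fderiv_conormal_self hp (hθ k) (ht k), zero_smul]
  · rw [h.inner_fderiv_fderiv_conormal_self hp (hθ k) (ht k), zero_smul]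

theorem secondFundamentalForm_self {i j : Fin 2} (hij : i ≠ j) :
    secondFundamentalForm X p (t i) (t i) =
      ⟪fderiv ℝ (fderiv ℝ X) p (t i) (t i), conormal P (θ j) (T j p)⟫ •
        conormal P (θ j) (T j p) := by
  rw [h.secondFundamentalForm_eq_sum hθ hp]
  refine Finset.sum_eq_single j (fun k _ hkj => ?_) (by simp)
  rw [show k = i by omega, h.inner_fderiv_fderiv_conormal_self hp (hθ i) (ht i), zero_smul]

theorem secondFundamentalForm_eq_sum_self (a b : EuclideanSpace ℝ (Fin 2)) :
    secondFundamentalForm X p a b = ∑ i, (⟪T i p, fderiv ℝ X p a⟫ * ⟪T i p, fderiv ℝ X p b⟫) •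
      secondFundamentalForm X p (t i) (t i) := by
  have hsum (a : EuclideanSpace ℝ (Fin 2)) : a = ∑ i, ⟪T i p, fderiv ℝ X p a⟫ • t i := by
    apply h.injective_fderiv hp
    simp only [map_sum, map_smul, ht]
    exact h.fderiv_eq_sum hp a
  have h01 := h.secondFundamentalForm_of_ne hθ hp ht zero_ne_one
  have h10 := h.secondFundamentalForm_of_ne hθ hp ht one_ne_zero
  simp only [secondFundamentalForm] at h01 h10 ⊢
  conv_lhs => rw [hsum a, hsum b]
  simp only [Fin.sum_univ_two, map_add, map_smul, add_apply,
    smul_apply, h01, h10]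
  module

theorem firstNormalSpace_eq_span :
    firstNormalSpace X p =
      Submodule.span ℝ (Set.range fun i => secondFundamentalForm X p (t i) (t i)) := by
  refine le_antisymm (Submodule.span_le.2 ?_) (Submodule.span_mono ?_)
  · rintro _ ⟨a, b, rfl⟩
    rw [h.secondFundamentalForm_eq_sum_self hθ hp ht]
    exact Submodule.sum_mem _ fun i _ =>
      Submodule.smul_mem _ _ (Submodule.subset_span (Set.mem_range_self i))
  · rintro _ ⟨i, rfl⟩
    exact ⟨t i, t i, rfl⟩

theorem secondFundamentalForm_self_ne_zero_iff {i j : Fin 2} (hij : i ≠ j)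
    (hne : Real.tan (θ i) ^ 2 ≠ Real.tan (θ j) ^ 2) :
    secondFundamentalForm X p (t i) (t i) ≠ 0 ↔ connectionForm P T i j p (t i) ≠ 0 := by
  have hN := ((h.isPrincipalFamily hp).orthonormal_conormal hθ).ne_zero j
  have hcot : Real.cot (θ j) ≠ 0 := by rw [← Real.tan_inv_eq_cot]; exact inv_ne_zero (hθ j)
  rw [h.secondFundamentalForm_self hθ hp ht hij, h.inner_fderiv_fderiv_self_conormal hp hθ (ht i),
    smul_ne_zero_iff_left hN, mul_ne_zero_iff_left (mul_ne_zero hcot (sub_ne_zero.2 hne))]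

theorem finrank_firstNormalSpace_eq_two_iff_linearIndependent :
    Module.finrank ℝ (firstNormalSpace X p) = 2 ↔
      LinearIndependent ℝ fun i => secondFundamentalForm X p (t i) (t i) := by
  rw [h.firstNormalSpace_eq_span hθ hp ht, linearIndependent_iff_card_eq_finrank_span,
    Fintype.card_fin, eq_comm]
  rfl

theorem finrank_firstNormalSpace_eq_two_iff (hne : Real.tan (θ 0) ^ 2 ≠ Real.tan (θ 1) ^ 2) :
    Module.finrank ℝ (firstNormalSpace X p) = 2 ↔
      ∀ i j, i ≠ j → connectionForm P T i j p (t i) ≠ 0 := by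
  have hne' {i j : Fin 2} (hij : i ≠ j) : Real.tan (θ i) ^ 2 ≠ Real.tan (θ j) ^ 2 := by
    obtain ⟨rfl, rfl⟩ | ⟨rfl, rfl⟩ : i = 0 ∧ j = 1 ∨ i = 1 ∧ j = 0 := by omega
    exacts [hne, hne.symm]
  rw [h.finrank_firstNormalSpace_eq_two_iff_linearIndependent hθ hp ht]
  constructor
  · intro hli i j hij
    exact (h.secondFundamentalForm_self_ne_zero_iff hθ hp ht hij (hne' hij)).1 (hli.ne_zero i)
  · intro hΓ
    refine linearIndependent_of_ne_zero_of_inner_eq_zero (𝕜 := ℝ) (fun i => ?_) fun i j hij => ?_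
    · obtain ⟨j, hij⟩ := exists_ne i
      exact (h.secondFundamentalForm_self_ne_zero_iff hθ hp ht hij.symm (hne' hij.symm)).2
        (hΓ i j hij.symm)
    · change ⟪_, _⟫ = (0 : ℝ)
      rw [h.secondFundamentalForm_self hθ hp ht hij,
        h.secondFundamentalForm_self hθ hp ht hij.symm, real_inner_smul_left,
        real_inner_smul_right, ((h.isPrincipalFamily hp).orthonormal_conormal hθ).2 hij.symm,
        mul_zero, mul_zero]

end IsPrincipalFrame

end FirstNormalSpace

section IsometricImmersion

open Filter Topology

variable {G H E : Type*} [NormedAddCommGroup G] [NormedSpace ℝ G]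
  [NormedAddCommGroup H] [InnerProductSpace ℝ H] [NormedAddCommGroup E] [InnerProductSpace ℝ E]

theorem inner_self_smul_eq_inner_smul_of_finrank_eq_one {K : Submodule ℝ E}
    (hK : Module.finrank ℝ K = 1) {x y : E} (hx : x ∈ K) (hy : y ∈ K) :
    ⟪x, x⟫ • y = ⟪x, y⟫ • x := by
  obtain ⟨v, -, hv⟩ := finrank_eq_one_iff'.1 hK
  obtain ⟨a, ha⟩ := hv ⟨x, hx⟩
  obtain ⟨b, hb⟩ := hv ⟨y, hy⟩
  obtain rfl : a • (v : E) = x := congrArg Subtype.val ha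
  obtain rfl : b • (v : E) = y := congrArg Subtype.val hb
  simp only [real_inner_smul_left, real_inner_smul_right, smul_smul]
  ring_nf

theorem inner_eq_zero_of_mem_of_finrank_eq_one {K : Submodule ℝ E}
    (hK : Module.finrank ℝ K = 1) {x y z : E} (hx : x ∈ K) (hx0 : x ≠ 0) (hy : y ∈ K)
    (hxz : ⟪x, z⟫ = 0) : ⟪y, z⟫ = 0 := by
  have h := congrArg (fun u => ⟪u, z⟫) (inner_self_smul_eq_inner_smul_of_finrank_eq_one hK hx hy)
  simp only [real_inner_smul_left, hxz, mul_zero] at h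
  exact (mul_eq_zero.1 h).resolve_left (inner_self_ne_zero.2 hx0)

/-- The normal space at `q` of the map `F : H → E`: the orthogonal complement of the range of
its derivative. -/
def normalSpace (F : H → E) (q : H) : Submodule ℝ E :=
  (LinearMap.range (fderiv ℝ F q : H →ₗ[ℝ] E))ᗮ

theorem mem_normalSpace_iff {F : H → E} {q : H} {η : E} :
    η ∈ normalSpace F q ↔ ∀ w, ⟪fderiv ℝ F q w, η⟫ = 0 := by
  simp [normalSpace, Submodule.mem_orthogonal]

/-- `F` is a smooth isometric immersion of the open set `W` of the Euclidean space `H`. -/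
structure IsIsometricImmersionOn (W : Set H) (F : H → E) : Prop where
  isOpen : IsOpen W
  contDiffOn : ContDiffOn ℝ ∞ F W
  inner_fderiv {q : H} (hq : q ∈ W) (a b : H) : ⟪fderiv ℝ F q a, fderiv ℝ F q b⟫ = ⟪a, b⟫

namespace IsIsometricImmersionOn

variable {W : Set H} {F : H → E} (hF : IsIsometricImmersionOn W F)
include hF

section Normal

variable {q : H} (hq : q ∈ W)
include hq

theorem contDiffAt : ContDiffAt ℝ ∞ F q := hF.contDiffOn.contDiffAt (hF.isOpen.mem_nhds hq)

theorem injective_fderiv : Function.Injective (fderiv ℝ F q) := by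
  refine (injective_iff_map_eq_zero _).2 fun a ha => ?_
  rw [← inner_self_eq_zero (𝕜 := ℝ), ← hF.inner_fderiv hq, ha, inner_zero_left]

theorem finrank_normalSpace_eq_one [FiniteDimensional ℝ E]
    (hcodim : Module.finrank ℝ E = Module.finrank ℝ H + 1) :
    Module.finrank ℝ (normalSpace F q) = 1 := by
  have hrange := LinearMap.finrank_range_of_inj (f := (fderiv ℝ F q : H →ₗ[ℝ] E))
    (hF.injective_fderiv hq)
  have hadd := (LinearMap.range (fderiv ℝ F q : H →ₗ[ℝ] E)).finrank_add_finrank_orthogonal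
  rw [normalSpace]
  omega

theorem fderiv_fderiv_mem_normalSpace (a b : H) :
    fderiv ℝ (fderiv ℝ F) q a b ∈ normalSpace F q := by
  refine mem_normalSpace_iff.2 fun c => ?_
  -- Koszul: `⟪D²F(a, b), DF c⟫` is symmetric in `a, b` and antisymmetric in `b, c`.
  have hantisymm (a b c : H) : ⟪fderiv ℝ F q b, fderiv ℝ (fderiv ℝ F) q a c⟫ +
      ⟪fderiv ℝ F q c, fderiv ℝ (fderiv ℝ F) q a b⟫ = 0 := by
    rw [real_inner_comm _ (fderiv ℝ F q c)]
    refine inner_add_inner_eq_zero_of_eventually_inner_eq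
      (hasFDerivAt_fderiv_apply (hF.contDiffAt hq) b)
      (hasFDerivAt_fderiv_apply (hF.contDiffAt hq) c) (c := ⟪b, c⟫) ?_ a
    filter_upwards [hF.isOpen.mem_nhds hq] with r hr using hF.inner_fderiv hr b c
  have hsymm := fderiv_fderiv_comm_of_contDiffAt (hF.contDiffAt hq)
  have hbca := hantisymm b c a
  have hcab := hantisymm c a b
  rw [hsymm b a] at hbca
  rw [hsymm c b, hsymm c a] at hcab
  linarith [hantisymm a b c]

theorem inner_fderiv_fderiv_self_eq (a b : H) :
    ⟪fderiv ℝ (fderiv ℝ F) q a a, fderiv ℝ (fderiv ℝ F) q b b⟫ =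
      ⟪fderiv ℝ (fderiv ℝ F) q a b, fderiv ℝ (fderiv ℝ F) q a b⟫ := by
  have hF' : ContDiffAt ℝ ∞ (fderiv ℝ F) q := (hF.contDiffAt hq).fderiv_right (by simp)
  have hthird (a b c d : H) : ⟪fderiv ℝ F q d, fderiv ℝ (fderiv ℝ (fderiv ℝ F)) q a b c⟫ +
      ⟪fderiv ℝ (fderiv ℝ F) q a d, fderiv ℝ (fderiv ℝ F) q b c⟫ = 0 := by
    have hbc : HasFDerivAt (fun r => fderiv ℝ (fderiv ℝ F) r b c)
        (((fderiv ℝ (fderiv ℝ (fderiv ℝ F)) q).flip b).flip c) q :=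
      ((hasFDerivAt_fderiv_apply hF' b).clm_apply (hasFDerivAt_const c q)).congr_fderiv
        (by ext; simp)
    refine inner_add_inner_eq_zero_of_eventually_inner_eq
      (hasFDerivAt_fderiv_apply (hF.contDiffAt hq) d) hbc (c := 0) ?_ a
    filter_upwards [hF.isOpen.mem_nhds hq] with r hr
    exact mem_normalSpace_iff.1 (hF.fderiv_fderiv_mem_normalSpace hr b c) d
  have hbaab := hthird b a a b
  have habab := hthird a b a b
  rw [fderiv_fderiv_comm_of_contDiffAt hF' b a, real_inner_comm (fderiv ℝ (fderiv ℝ F) q a a)]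
    at hbaab
  rw [fderiv_fderiv_comm_of_contDiffAt (hF.contDiffAt hq) b a] at habab
  linarith

theorem fderiv_fderiv_eq_zero_of_self {a : H} (ha : fderiv ℝ (fderiv ℝ F) q a a = 0) (b : H) :
    fderiv ℝ (fderiv ℝ F) q a b = 0 := by
  rw [← inner_self_eq_zero (𝕜 := ℝ), ← hF.inner_fderiv_fderiv_self_eq hq, ha, inner_zero_left]

variable (hline : Module.finrank ℝ (normalSpace F q) = 1) {η : E} (hη : η ∈ normalSpace F q)
include hline hη

theorem inner_fderiv_fderiv_mul_inner_fderiv_fderiv (a b : H) :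
    ⟪fderiv ℝ (fderiv ℝ F) q a a, η⟫ * ⟪fderiv ℝ (fderiv ℝ F) q b b, η⟫ =
      ⟪fderiv ℝ (fderiv ℝ F) q a b, η⟫ ^ 2 := by
  have hinner (a b c d : H) :
      ⟪fderiv ℝ (fderiv ℝ F) q a b, η⟫ * ⟪fderiv ℝ (fderiv ℝ F) q c d, η⟫ =
        ⟪η, η⟫ * ⟪fderiv ℝ (fderiv ℝ F) q a b, fderiv ℝ (fderiv ℝ F) q c d⟫ := by
    rw [← real_inner_smul_right _ _ ⟪η, η⟫, inner_self_smul_eq_inner_smul_of_finrank_eq_one hline hη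
      (hF.fderiv_fderiv_mem_normalSpace hq c d), real_inner_smul_right,
      real_inner_comm _ (fderiv ℝ (fderiv ℝ F) q c d), mul_comm]
  rw [hinner, hF.inner_fderiv_fderiv_self_eq hq, ← hinner, sq]

theorem fderiv_fderiv_self_eq_zero_of_inner_eq_zero (hη0 : η ≠ 0) {a : H}
    (ha : ⟪fderiv ℝ (fderiv ℝ F) q a a, η⟫ = 0) : fderiv ℝ (fderiv ℝ F) q a a = 0 := by
  have := inner_self_smul_eq_inner_smul_of_finrank_eq_one hline hη
    (hF.fderiv_fderiv_mem_normalSpace hq a a)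
  rw [real_inner_comm (fderiv ℝ (fderiv ℝ F) q a a), ha, zero_smul] at this
  exact (smul_eq_zero.1 this).resolve_left (inner_self_ne_zero.2 hη0)

end Normal

section Composition

variable {X : G → E} {g : G → H} {p : G} (hgp : g p ∈ W)
include hgp

theorem fderiv_eq_of_eventuallyEq_comp (hg : DifferentiableAt ℝ g p) (hX : X =ᶠ[𝓝 p] F ∘ g) :
    fderiv ℝ X p = fderiv ℝ F (g p) ∘L fderiv ℝ g p := by
  rw [hX.fderiv_eq]
  exact fderiv_comp p ((hF.contDiffAt hgp).differentiableAt (by simp)) hg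

variable (hg : ContDiffAt ℝ ∞ g p)
include hg

theorem hasFDerivAt_fderiv_comp_apply (w : H) :
    HasFDerivAt (fun q => fderiv ℝ F (g q) w)
      ((fderiv ℝ (fderiv ℝ F) (g p)).flip w ∘L fderiv ℝ g p) p :=
  (hasFDerivAt_fderiv_apply (hF.contDiffAt hgp) w).comp p
    (hg.differentiableAt (by simp)).hasFDerivAt

variable (hX : X =ᶠ[𝓝 p] F ∘ g)
include hX

theorem inner_fderiv_fderiv_of_eventuallyEq_comp {η : E} (hη : η ∈ normalSpace F (g p)) (a b : G) :
    ⟪fderiv ℝ (fderiv ℝ X) p a b, η⟫ =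
      ⟪fderiv ℝ (fderiv ℝ F) (g p) (fderiv ℝ g p a) (fderiv ℝ g p b), η⟫ := by
  have hchain : (fun q => fderiv ℝ X q b) =ᶠ[𝓝 p] fun q => fderiv ℝ F (g q) (fderiv ℝ g q b) := by
    have hg₁ : ContDiffAt ℝ 1 g p := hg.of_le (by simp)
    filter_upwards [hX.eventuallyEq_nhds, hg₁.eventually (by simp),
      hg.continuousAt.eventually_mem (hF.isOpen.mem_nhds hgp)] with q hq hgq hgqW
    rw [hF.fderiv_eq_of_eventuallyEq_comp hgqW (hgq.differentiableAt (by simp)) hq,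
      ContinuousLinearMap.comp_apply]
  have hFg : HasFDerivAt (fun q => fderiv ℝ F (g q))
      (fderiv ℝ (fderiv ℝ F) (g p) ∘L fderiv ℝ g p) p :=
    (((hF.contDiffAt hgp).fderiv_right (m := ∞) (by simp)).differentiableAt
      (by simp)).hasFDerivAt.comp p (hg.differentiableAt (by simp)).hasFDerivAt
  have hcomp := (hFg.clm_apply (hasFDerivAt_fderiv_apply hg b)).congr_of_eventuallyEq hchain
  have hXp : ContDiffAt ℝ ∞ X p := ((hF.contDiffAt hgp).comp p hg).congr_of_eventuallyEq hX
  have happly := DFunLike.congr_fun ((hasFDerivAt_fderiv_apply hXp b).unique hcomp) a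
  simp only [ContinuousLinearMap.flip_apply, add_apply, ContinuousLinearMap.comp_apply] at happly
  rw [happly, inner_add_left, mem_normalSpace_iff.1 hη, zero_add]

theorem fderiv_apply_mem_normalSpace (hline : Module.finrank ℝ (normalSpace F (g p)) = 1)
    {N : G → E} {N' : G →L[ℝ] E} (hN : HasFDerivAt N N' p)
    (hmem : ∀ᶠ q in 𝓝 p, N q ∈ normalSpace F (g q)) (hNp : N p ≠ 0) {t : G}
    (ht : ⟪fderiv ℝ (fderiv ℝ X) p t t, N p⟫ = 0) : N' t ∈ normalSpace F (g p) := by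
  refine mem_normalSpace_iff.2 fun w => ?_
  have hNmem := hmem.self_of_nhds
  rw [hF.inner_fderiv_fderiv_of_eventuallyEq_comp hgp hg hX hNmem] at ht
  -- In codimension one the Gauss equation makes an asymptotic direction a null direction of `D²F`.
  have hnull := hF.fderiv_fderiv_eq_zero_of_self hgp
    (hF.fderiv_fderiv_self_eq_zero_of_inner_eq_zero hgp hline hNmem hNp ht) w
  have := inner_add_inner_eq_zero_of_eventually_inner_eq
    (hF.hasFDerivAt_fderiv_comp_apply hgp hg w) hN
    (hmem.mono fun q hq => mem_normalSpace_iff.1 hq w) t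
  simpa [hnull] using this

end Composition

end IsIsometricImmersionOn

end IsometricImmersion

section Composition

open Filter Topology

theorem IsComposition.mono {U V : Set (EuclideanSpace ℝ (Fin 2))}
    {X : EuclideanSpace ℝ (Fin 2) → EuclideanSpace ℝ (Fin 4)} (h : IsComposition U X)
    (hVU : V ⊆ U) : IsComposition V X := by
  obtain ⟨W, g, F, hW, hg, hgW, hiso, hF, hFiso, hX⟩ := h
  exact ⟨W, g, F, hW, hg.mono hVU, hgW.mono_left hVU, fun p hp => hiso p (hVU hp), hF, hFiso,
    hX.mono hVU⟩

theorem eventually_notMem_normalSpace {G H E : Type*} [NormedAddCommGroup G] [NormedSpace ℝ G]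
    [NormedAddCommGroup H] [InnerProductSpace ℝ H] [NormedAddCommGroup E] [InnerProductSpace ℝ E]
    {F : H → E} {g : G → H} {N : G → E} {p : G} (hF : ContinuousAt (fderiv ℝ F) (g p))
    (hg : ContinuousAt g p) (hN : ContinuousAt N p) (hNp : N p ∉ normalSpace F (g p)) :
    ∀ᶠ q in 𝓝 p, N q ∉ normalSpace F (g q) := by
  obtain ⟨w, hw⟩ := not_forall.1 (mt mem_normalSpace_iff.2 hNp)
  have hcont : ContinuousAt (fun q => ⟪fderiv ℝ F (g q) w, N q⟫) p :=
    ((hF.comp hg).clm_apply continuousAt_const).inner hN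
  filter_upwards [hcont.eventually_ne hw] with q hq hNq using hq (mem_normalSpace_iff.1 hNq w)

namespace IsPrincipalFrame

variable {V : Set (EuclideanSpace ℝ (Fin 2))}
  {X : EuclideanSpace ℝ (Fin 2) → EuclideanSpace ℝ (Fin 4)}
  {P : Submodule ℝ (EuclideanSpace ℝ (Fin 4))} {θ : Fin 2 → ℝ}
  {T : Fin 2 → EuclideanSpace ℝ (Fin 2) → EuclideanSpace ℝ (Fin 4)}
  (h : IsPrincipalFrame V X P θ T) (hθ : ∀ i, Real.tan (θ i) ≠ 0)
  {H : Type*} [NormedAddCommGroup H] [InnerProductSpace ℝ H] {W : Set H}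
  {F : H → EuclideanSpace ℝ (Fin 4)} {g : EuclideanSpace ℝ (Fin 2) → H}
  {p : EuclideanSpace ℝ (Fin 2)} (hp : p ∈ V)
include h hθ hp

theorem exists_inner_conormal_eq_zero
    (hfull : Module.finrank ℝ (firstNormalSpace X p) = 2)
    {η : EuclideanSpace ℝ (Fin 4)} (hη : η ∈ (tangentPlane X p)ᗮ)
    (hdet : ∀ a b, ⟪fderiv ℝ (fderiv ℝ X) p a a, η⟫ * ⟪fderiv ℝ (fderiv ℝ X) p b b, η⟫ =
      ⟪fderiv ℝ (fderiv ℝ X) p a b, η⟫ ^ 2) :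
    ∃ j, ⟪conormal P (θ j) (T j p), η⟫ = 0 := by
  choose t ht using fun i => h.mem_range hp i
  have hα (a b : EuclideanSpace ℝ (Fin 2)) :
      ⟪fderiv ℝ (fderiv ℝ X) p a b, η⟫ = ⟪secondFundamentalForm X p a b, η⟫ :=
    (inner_starProjection_left_of_mem _ hη).symm
  have hκ {i j : Fin 2} (hij : i ≠ j) (hi : ⟪secondFundamentalForm X p (t i) (t i), η⟫ = 0) :
      ⟪conormal P (θ j) (T j p), η⟫ = 0 := by
    have hself :=
      ((h.finrank_firstNormalSpace_eq_two_iff_linearIndependent hθ hp ht).1 hfull).ne_zero i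
    rw [h.secondFundamentalForm_self hθ hp ht hij] at hi hself
    rw [real_inner_smul_left] at hi
    exact (mul_eq_zero.1 hi).resolve_left (left_ne_zero_of_smul hself)
  have h01 := hdet (t 0) (t 1)
  rw [hα, hα, hα, h.secondFundamentalForm_of_ne hθ hp ht zero_ne_one, inner_zero_left,
    zero_pow two_ne_zero, mul_eq_zero] at h01
  exact h01.elim (fun h0 => ⟨1, hκ zero_ne_one h0⟩) fun h1 => ⟨0, hκ one_ne_zero h1⟩

variable (hF : IsIsometricImmersionOn W F) (hg : ContDiffOn ℝ ∞ g V) (hgW : Set.MapsTo g V W)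
  (hX : Set.EqOn X (F ∘ g) V)
include hF hg hgW hX

theorem exists_conormal_mem_normalSpace
    (hline : Module.finrank ℝ (normalSpace F (g p)) = 1)
    (hfull : Module.finrank ℝ (firstNormalSpace X p) = 2) :
    ∃ i, conormal P (θ i) (T i p) ∈ normalSpace F (g p) := by
  have hV : V ∈ 𝓝 p := h.isOpen.mem_nhds hp
  have hXp : X =ᶠ[𝓝 p] F ∘ g := hX.eventuallyEq_of_mem hV
  have hgp : ContDiffAt ℝ ∞ g p := hg.contDiffAt hV
  obtain ⟨η, hη, hη0⟩ : ∃ η ∈ normalSpace F (g p), η ≠ 0 :=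
    Submodule.exists_mem_ne_zero_of_ne_bot fun hbot => by
      rw [hbot, finrank_bot] at hline
      exact zero_ne_one hline
  have hηX : η ∈ (tangentPlane X p)ᗮ := by
    refine mem_normalSpace_iff.2 fun a => ?_
    rw [hF.fderiv_eq_of_eventuallyEq_comp (hgW hp) (hgp.differentiableAt (by simp)) hXp]
    exact mem_normalSpace_iff.1 hη _
  obtain ⟨j, hj⟩ := h.exists_inner_conormal_eq_zero hθ hp hfull hηX fun a b => by
    simp only [hF.inner_fderiv_fderiv_of_eventuallyEq_comp (hgW hp) hgp hXp hη]
    exact hF.inner_fderiv_fderiv_mul_inner_fderiv_fderiv (hgW hp) hline hη _ _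
  obtain ⟨i, hij⟩ := exists_ne j
  have hηi : η = ⟪conormal P (θ i) (T i p), η⟫ • conormal P (θ i) (T i p) := by
    conv_lhs => rw [← (tangentPlane X p)ᗮ.starProjection_eq_self_iff.2 hηX,
      h.starProjection_orthogonal_tangentPlane_eq_sum hθ hp]
    refine Finset.sum_eq_single i (fun k _ hki => ?_) (by simp)
    rw [show k = j by omega, hj, zero_smul]
  refine ⟨i, ?_⟩
  rw [hηi] at hη hη0
  exact (Submodule.smul_mem_iff _ (left_ne_zero_of_smul hη0)).1 hη

theorem connectionForm_eq_zero_of_conormal_mem_normalSpace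
    (hline : ∀ q ∈ V, Module.finrank ℝ (normalSpace F (g q)) = 1)
    (hfull : ∀ q ∈ V, Module.finrank ℝ (firstNormalSpace X q) = 2) {i j : Fin 2} (hij : i ≠ j)
    (hi : conormal P (θ i) (T i p) ∈ normalSpace F (g p)) {t : EuclideanSpace ℝ (Fin 2)}
    (ht : fderiv ℝ X p t = T i p) : connectionForm P T i j p t = 0 := by
  have hV : V ∈ 𝓝 p := h.isOpen.mem_nhds hp
  have hgp : ContDiffAt ℝ ∞ g p := hg.contDiffAt hV
  have hN (k : Fin 2) : HasFDerivAt (fun q => conormal P (θ k) (T k q))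
      (conormal P (θ k) ∘L fderiv ℝ (T k) p) p :=
    (conormal P (θ k)).hasFDerivAt.comp p (h.hasFDerivAt_field hp k)
  have hortho := (h.isPrincipalFamily hp).orthonormal_conormal hθ
  have hNij : ⟪conormal P (θ i) (T i p), conormal P (θ j) (T j p)⟫ = 0 := hortho.2 hij
  have hj : conormal P (θ j) (T j p) ∉ normalSpace F (g p) := fun hj =>
    inner_self_ne_zero.2 (hortho.ne_zero j) (inner_eq_zero_of_mem_of_finrank_eq_one
      (hline p hp) hi (hortho.ne_zero i) hj hNij)
  have hmem : ∀ᶠ q in 𝓝 p, conormal P (θ i) (T i q) ∈ normalSpace F (g q) := by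
    have hdF : ContDiffAt ℝ ∞ (fderiv ℝ F) (g p) :=
      (hF.contDiffAt (hgW hp)).fderiv_right (by simp)
    filter_upwards [hV, eventually_notMem_normalSpace hdF.continuousAt hgp.continuousAt
      (hN j).continuousAt hj] with q hq hjq
    obtain ⟨k, hk⟩ := h.exists_conormal_mem_normalSpace hθ hq hF hg hgW hX (hline q hq) (hfull q hq)
    obtain rfl | rfl : k = i ∨ k = j := by omega
    exacts [hk, absurd hk hjq]
  have hparallel := hF.fderiv_apply_mem_normalSpace (hgW hp) hgp (hX.eventuallyEq_of_mem hV)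
    (hline p hp) (hN i) hmem (hortho.ne_zero i) (h.inner_fderiv_fderiv_conormal_self hp (hθ i) ht t)
  have hzero := inner_eq_zero_of_mem_of_finrank_eq_one (hline p hp) hi (hortho.ne_zero i)
    hparallel hNij
  rw [ContinuousLinearMap.comp_apply, h.inner_conormal_fderiv_conormal hp (hθ i) ht] at hzero
  refine (mul_eq_zero.1 hzero).resolve_left (mul_ne_zero (hθ i) ?_)
  rw [← Real.tan_inv_eq_cot, ← mul_ne_zero_iff_right (hθ j)]
  field_simp [hθ j]
  positivity

end IsPrincipalFrame

variable {V : Set (EuclideanSpace ℝ (Fin 2))}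
  {X : EuclideanSpace ℝ (Fin 2) → EuclideanSpace ℝ (Fin 4)}
  {P : Submodule ℝ (EuclideanSpace ℝ (Fin 4))} {θ : Fin 2 → ℝ}
  {T : Fin 2 → EuclideanSpace ℝ (Fin 2) → EuclideanSpace ℝ (Fin 4)}

theorem IsPrincipalFrame.not_isComposition (h : IsPrincipalFrame V X P θ T)
    (hθ : ∀ i, Real.tan (θ i) ≠ 0) (hne : Real.tan (θ 0) ^ 2 ≠ Real.tan (θ 1) ^ 2)
    (hfull : ∀ q ∈ V, Module.finrank ℝ (firstNormalSpace X q) = 2) (hV : V.Nonempty) :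
    ¬ IsComposition V X := by
  rintro ⟨W, g, F, hW, hg, hgW, -, hF, hFiso, hX⟩
  have hiso : IsIsometricImmersionOn W F := ⟨hW, hF, fun hq => hFiso _ hq⟩
  have hline (q : EuclideanSpace ℝ (Fin 2)) (hq : q ∈ V) :
      Module.finrank ℝ (normalSpace F (g q)) = 1 :=
    hiso.finrank_normalSpace_eq_one (hgW hq) (by simp)
  obtain ⟨p, hp⟩ := hV
  obtain ⟨i, hi⟩ :=
    h.exists_conormal_mem_normalSpace hθ hp hiso hg hgW hX (hline p hp) (hfull p hp)
  obtain ⟨j, hj⟩ := exists_ne i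
  choose t ht using fun i => h.mem_range hp i
  exact (h.finrank_firstNormalSpace_eq_two_iff hθ hp ht hne).1 (hfull p hp) i j hj.symm
    (h.connectionForm_eq_zero_of_conormal_mem_normalSpace hθ hp hiso hg hgW hX hline hfull hj.symm
      hi (ht i))

end Composition

section PrincipalFields

variable {U V : Set (EuclideanSpace ℝ (Fin 2))}
  {X : EuclideanSpace ℝ (Fin 2) → EuclideanSpace ℝ (Fin 4)}
  {P : Submodule ℝ (EuclideanSpace ℝ (Fin 4))}

theorem IsImmersedSurface.mono (hX : IsImmersedSurface U X) (hVU : V ⊆ U) (hV : IsOpen V)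
    (hne : V.Nonempty) : IsImmersedSurface V X :=
  ⟨hV, hne, hX.smooth.mono hVU, fun p hp => hX.immersion p (hVU hp)⟩

theorem HasConstantPrincipalAngles.mono {θ₁ θ₂ : ℝ} (h : HasConstantPrincipalAngles U X P θ₁ θ₂)
    (hVU : V ⊆ U) : HasConstantPrincipalAngles V X P θ₁ θ₂ :=
  ⟨h.1, fun p hp => h.2 p (hVU hp)⟩

theorem IsPrincipalField.mono {θ : ℝ} {T : EuclideanSpace ℝ (Fin 2) → EuclideanSpace ℝ (Fin 4)}
    (hT : IsPrincipalField U X P θ T) (hVU : V ⊆ U) : IsPrincipalField V X P θ T :=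
  ⟨hT.1.mono hVU, fun p hp => hT.2 p (hVU hp)⟩

theorem hasEigenvector_angleOperator_iff {W K : Submodule ℝ (EuclideanSpace ℝ (Fin 4))} {c : ℝ}
    {v : EuclideanSpace ℝ (Fin 4)} (hv : v ∈ K) :
    (angleOperator W K).HasEigenvector c ⟨v, hv⟩ ↔
      K.starProjection (W.starProjection v) = c • v ∧ v ≠ 0 := by
  rw [Module.End.hasEigenvector_iff, Module.End.mem_eigenspace_iff, Subtype.ext_iff, ne_eq,
    Submodule.mk_eq_zero]
  rfl

theorem cos_sq_ne_of_tan_sq_ne {x y : ℝ} (h : Real.tan x ^ 2 ≠ Real.tan y ^ 2) :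
    Real.cos x ^ 2 ≠ Real.cos y ^ 2 := by
  contrapose! h
  rw [Real.tan_eq_sin_div_cos, Real.tan_eq_sin_div_cos, div_pow, div_pow, Real.sin_sq, Real.sin_sq,
    h]

theorem exists_isPrincipalField_of_eigenfield (hU : IsOpen U) {θ : ℝ}
    {w : EuclideanSpace ℝ (Fin 2) → EuclideanSpace ℝ (Fin 4)} (hw : ContDiffOn ℝ ∞ w U)
    (hmem : ∀ q ∈ U, w q ∈ tangentPlane X q)
    (heig : ∀ q ∈ U,
      (tangentPlane X q).starProjection (P.starProjection (w q)) = Real.cos θ ^ 2 • w q)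
    {p : EuclideanSpace ℝ (Fin 2)} (hp : p ∈ U) (hwp : w p ≠ 0) :
    ∃ V ⊆ U, IsOpen V ∧ p ∈ V ∧ ∃ T, IsPrincipalField V X P θ T := by
  have hVU : U ∩ w ⁻¹' {0}ᶜ ⊆ U := Set.inter_subset_left
  have hw' := hw.mono hVU
  refine ⟨U ∩ w ⁻¹' {0}ᶜ, hVU, hw.continuousOn.isOpen_inter_preimage hU isOpen_compl_singleton,
    ⟨hp, hwp⟩, fun q => ‖w q‖⁻¹ • w q,
    ((hw'.norm ℝ fun q hq => hq.2).inv fun q hq => norm_ne_zero_iff.2 hq.2).smul hw', ?_⟩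
  rintro q ⟨hq, hwq : w q ≠ 0⟩
  refine ⟨norm_smul_inv_norm hwq, Submodule.smul_mem _ _ (hmem q hq), ?_⟩
  rw [hasEigenvector_angleOperator_iff, map_smul, map_smul, heig q hq, smul_comm]
  exact ⟨rfl, smul_ne_zero (inv_ne_zero (norm_ne_zero_iff.2 hwq)) hwq⟩

variable {θ : Fin 2 → ℝ}

theorem isPrincipalFrame_of_isPrincipalField (hV : IsOpen V) (hX : ContDiffOn ℝ ∞ X V)
    {T : Fin 2 → EuclideanSpace ℝ (Fin 2) → EuclideanSpace ℝ (Fin 4)}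
    (hT : ∀ i, IsPrincipalField V X P (θ i) (T i))
    (hne : Real.cos (θ 0) ^ 2 ≠ Real.cos (θ 1) ^ 2) : IsPrincipalFrame V X P θ T where
  card_eq_finrank := by simp
  isOpen := hV
  contDiffOn := hX
  contDiffOn_field i := (hT i).1
  mem_range hp i := ((hT i).2 _ hp).2.fst
  isPrincipalFamily hp := by
    refine .of_starProjection_starProjection (fun i => ((hT i).2 _ hp).2.fst)
      (fun i => ((hT i).2 _ hp).1)
      (fun i => ((hasEigenvector_angleOperator_iff _).1 ((hT i).2 _ hp).2.snd).1) ?_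
    simp [Function.Injective, Fin.forall_fin_two, hne, hne.symm]

theorem IsPrincipalFrame.covariantDerivative_ne_zero (hθ : ∀ i, Real.tan (θ i) ≠ 0)
    (hne : Real.tan (θ 0) ^ 2 ≠ Real.tan (θ 1) ^ 2)
    {T : Fin 2 → EuclideanSpace ℝ (Fin 2) → EuclideanSpace ℝ (Fin 4)}
    (h : IsPrincipalFrame V X P θ T) {p t : EuclideanSpace ℝ (Fin 2)} (hp : p ∈ V)
    (hfull : Module.finrank ℝ (firstNormalSpace X p) = 2) {i : Fin 2}
    (ht : fderiv ℝ X p t = T i p) : covariantDerivative X (T i) p t ≠ 0 := by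
  obtain ⟨j, hji⟩ := exists_ne i
  choose s hs using h.mem_range hp
  obtain rfl : t = s i := h.injective_fderiv hp (ht.trans (hs i).symm)
  have hΓ := (h.finrank_firstNormalSpace_eq_two_iff hθ hp hs hne).1 hfull i j hji.symm
  have hTj : T j p ∈ tangentPlane X p := h.mem_range hp j
  intro hcov
  have hinner := h.inner_fderiv_field hp (hθ i) ht j
  rw [← inner_starProjection_left_of_mem _ hTj, ← covariantDerivative, hcov, inner_zero_left]
    at hinner
  exact mul_ne_zero (by positivity) hΓ hinner.symm

variable (hX : IsImmersedSurface U X) (hangles : HasConstantPrincipalAngles U X P (θ 0) (θ 1))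
include hX hangles

theorem exists_isPrincipalField (hne : Real.cos (θ 0) ^ 2 ≠ Real.cos (θ 1) ^ 2) (i : Fin 2)
    {p : EuclideanSpace ℝ (Fin 2)} (hp : p ∈ U) :
    ∃ V ⊆ U, IsOpen V ∧ p ∈ V ∧ ∃ T, IsPrincipalField V X P (θ i) T := by
  obtain ⟨j, hji⟩ := exists_ne i
  have hfinrank {q : EuclideanSpace ℝ (Fin 2)} (hq : q ∈ U) :
      Fintype.card (Fin 2) = Module.finrank ℝ (tangentPlane X q) := by
    rw [tangentPlane, LinearMap.finrank_range_of_inj (hX.immersion q hq)]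
    simp
  choose! v hv hmem using fun q hq => (hangles.2 q hq).exists_isPrincipalFamily hangles.1
  let S (q : EuclideanSpace ℝ (Fin 2)) := (tangentPlane X q).starProjection
  have hS : ContDiffOn ℝ ∞ S U := contDiffOn_starProjection_range
    (hX.smooth.fderiv_of_isOpen hX.isOpen (by simp)) hX.immersion
  have hSv : ContDiffOn ℝ ∞ (fun q => S q (v p i)) U := hS.clm_apply contDiffOn_const
  -- Subtracting the eigenvalue of `v q j` kills the `v q j` component and leaves a smooth field of
  -- eigenvectors.
  let w (q : EuclideanSpace ℝ (Fin 2)) :=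
    S q (P.starProjection (S q (v p i))) - Real.cos (θ j) ^ 2 • S q (v p i)
  have hw {q : EuclideanSpace ℝ (Fin 2)} (hq : q ∈ U) :
      w q = ((Real.cos (θ i) ^ 2 - Real.cos (θ j) ^ 2) * ⟪v q i, v p i⟫) • v q i :=
    (hv q hq).starProjection_starProjection_starProjection_sub_smul (hmem q hq) (hfinrank hq)
      (fun k => by omega) _
  refine exists_isPrincipalField_of_eigenfield (w := w) hX.isOpen
    ((hS.clm_apply (P.starProjection.contDiff.comp_contDiffOn hSv)).sub (hSv.const_smul _))
    (fun q hq => hw hq ▸ Submodule.smul_mem _ _ (hmem q hq i)) (fun q hq => ?_) hp ?_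
  · rw [hw hq, map_smul, map_smul, (hv q hq).starProjection_starProjection (hmem q hq)
      (hfinrank hq), smul_comm]
  · have hij : Real.cos (θ i) ^ 2 - Real.cos (θ j) ^ 2 ≠ 0 := by
      obtain ⟨rfl, rfl⟩ | ⟨rfl, rfl⟩ : i = 0 ∧ j = 1 ∨ i = 1 ∧ j = 0 := by omega
      exacts [sub_ne_zero.2 hne, sub_ne_zero.2 hne.symm]
    rw [hw hp, (hv p hp).inner_self, mul_one]
    exact smul_ne_zero hij ((hv p hp).orthonormal.ne_zero i)

theorem exists_forall_isPrincipalField (hne : Real.cos (θ 0) ^ 2 ≠ Real.cos (θ 1) ^ 2)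
    {p : EuclideanSpace ℝ (Fin 2)} (hp : p ∈ U) :
    ∃ V ⊆ U, IsOpen V ∧ p ∈ V ∧
      ∃ T : Fin 2 → EuclideanSpace ℝ (Fin 2) → EuclideanSpace ℝ (Fin 4),
        ∀ i, IsPrincipalField V X P (θ i) (T i) := by
  choose V hVU hV hpV T hT using fun i => exists_isPrincipalField hX hangles hne i hp
  exact ⟨⋂ i, V i, (Set.iInter_subset V 0).trans (hVU 0), isOpen_iInter_of_finite hV,
    Set.mem_iInter.2 hpV, T, fun i => (hT i).mono (Set.iInter_subset V i)⟩

variable (hθ : ∀ i, Real.tan (θ i) ≠ 0) (hne : Real.tan (θ 0) ^ 2 ≠ Real.tan (θ 1) ^ 2)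
  (hfull : ∀ q ∈ U, Module.finrank ℝ (firstNormalSpace X q) = 2)

include hθ hne hfull

theorem IsPrincipalField.not_isGeodesicField {i : Fin 2}
    {T : EuclideanSpace ℝ (Fin 2) → EuclideanSpace ℝ (Fin 4)}
    (hT : IsPrincipalField U X P (θ i) T) : ¬ IsGeodesicField U X T := by
  intro hgeodesic
  obtain ⟨p, hp⟩ := hX.nonempty
  obtain ⟨V, hVU, hV, hpV, S, hS⟩ :=
    exists_forall_isPrincipalField hX hangles (cos_sq_ne_of_tan_sq_ne hne) hp
  have hframe : IsPrincipalFrame V X P θ (Function.update S i T) :=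
    isPrincipalFrame_of_isPrincipalField hV (hX.smooth.mono hVU)
      ((Function.forall_update_iff S fun k R => IsPrincipalField V X P (θ k) R).2
        ⟨hT.mono hVU, fun k _ => hS k⟩) (cos_sq_ne_of_tan_sq_ne hne)
  obtain ⟨t, ht⟩ := hframe.mem_range hpV i
  have hcov := hframe.covariantDerivative_ne_zero hθ hne hpV (hfull p hp) ht
  rw [Function.update_self] at ht hcov
  exact hcov (hgeodesic p hp t ht)

theorem IsImmersedSurface.not_isComposition : ¬ IsComposition U X := by
  obtain ⟨p, hp⟩ := hX.nonempty
  obtain ⟨V, hVU, hV, hpV, T, hT⟩ :=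
    exists_forall_isPrincipalField hX hangles (cos_sq_ne_of_tan_sq_ne hne) hp
  have hframe : IsPrincipalFrame V X P θ T := isPrincipalFrame_of_isPrincipalField hV
    (hX.smooth.mono hVU) hT (cos_sq_ne_of_tan_sq_ne hne)
  exact fun h => hframe.not_isComposition hθ hne (fun q hq => hfull q (hVU hq)) ⟨p, hpV⟩
    (h.mono hVU)

end PrincipalFields

section LocalEmbedding

variable {G F : Type*} [NormedAddCommGroup G] [NormedSpace ℝ G] [FiniteDimensional ℝ G]
  [NormedAddCommGroup F] [NormedSpace ℝ F]

theorem exists_isEmbedding_of_hasStrictFDerivAt_injective {f : G → F} {f' : G →L[ℝ] F} {p : G}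
    (hf : HasStrictFDerivAt f f' p) (hf' : Function.Injective f') :
    ∃ U, IsOpen U ∧ p ∈ U ∧ Topology.IsEmbedding (U.domRestrict f) := by
  obtain ⟨K, hK, hanti⟩ := (f' : G →ₗ[ℝ] F).exists_antilipschitzWith (LinearMap.ker_eq_bot.2 hf')
  have hpos : 0 < K⁻¹ / 2 := by positivity
  obtain ⟨s, hs, happrox⟩ := hf.approximates_deriv_on_nhds (c := K⁻¹ / 2) (Or.inr hpos)
  obtain ⟨U, hUs, hU, hpU⟩ := mem_nhds_iff.1 hs
  have happroxU := happrox.mono_set hUs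
  have hantiU : AntilipschitzWith (K⁻¹ - K⁻¹ / 2)⁻¹ (U.domRestrict f) := by
    convert! (AntilipschitzWith.domRestrict hanti U).add_lipschitzWith happroxU.lipschitz_sub
      (NNReal.half_lt_self (by positivity))
    simp [Set.domRestrict]
  exact ⟨U, hU, hpU,
    (hantiU.isUniformEmbedding happroxU.lipschitz.uniformContinuous).isEmbedding⟩

end LocalEmbedding

section ComplexCoordinates

open Complex

/-- The identification of `ℂ × ℂ` with `ℝ⁴`. It is only linear and not isometric for the sup norm of
the product; see `inner_ofComplexPair`. -/
def ofComplexPair : ℂ × ℂ →L[ℝ] EuclideanSpace ℝ (Fin 4) :=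
  LinearMap.toContinuousLinearMap
    { toFun z := !₂[z.1.re, z.1.im, z.2.re, z.2.im]
      map_add' z w := by ext i; fin_cases i <;> simp
      map_smul' c z := by ext i; fin_cases i <;> simp }

theorem inner_ofComplexPair (z w : ℂ × ℂ) :
    ⟪ofComplexPair z, ofComplexPair w⟫ = ⟪z.1, w.1⟫ + ⟪z.2, w.2⟫ := by
  simp only [ofComplexPair, LinearMap.coe_toContinuousLinearMap', LinearMap.coe_mk, AddHom.coe_mk,
    PiLp.inner_apply, Fin.sum_univ_four, RCLike.inner_apply, conj_trivial, Complex.inner, mul_re,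
    conj_re, conj_im, Matrix.cons_val, Matrix.cons_val_zero, Matrix.cons_val_one]
  ring

/-- The plane `ℂ × 0` in `ℝ⁴ = ℂ × ℂ`. -/
def firstComplexLine : Submodule ℝ (EuclideanSpace ℝ (Fin 4)) :=
  LinearMap.range (ofComplexPair ∘L .inl ℝ ℂ ℂ : ℂ →ₗ[ℝ] EuclideanSpace ℝ (Fin 4))

theorem starProjection_firstComplexLine (z : ℂ × ℂ) :
    firstComplexLine.starProjection (ofComplexPair z) = ofComplexPair (z.1, 0) := by
  refine Submodule.eq_starProjection_of_mem_of_inner_eq_zero ⟨z.1, rfl⟩ ?_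
  rintro _ ⟨w, rfl⟩
  change ⟪ofComplexPair z - ofComplexPair (z.1, 0), ofComplexPair (w, 0)⟫ = 0
  rw [← map_sub, inner_ofComplexPair]
  simp

theorem finrank_firstComplexLine : Module.finrank ℝ firstComplexLine = 2 := by
  rw [firstComplexLine, LinearMap.finrank_range_of_inj, Complex.finrank_real_complex]
  refine (injective_iff_map_eq_zero _).2 fun z hz => ?_
  have hinner := inner_ofComplexPair (z, 0) (z, 0)
  rw [show ofComplexPair (z, 0) = 0 from hz] at hinner
  simpa using hinner.symm

theorem inner_mul_mul_of_norm_eq_one {z : ℂ} (hz : ‖z‖ = 1) (x y : ℂ) :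
    ⟪z * x, z * y⟫ = ⟪x, y⟫ := by
  have hz' : z.re * z.re + z.im * z.im = 1 := by
    rw [← Complex.normSq_apply, Complex.normSq_eq_norm_sq, hz, one_pow]
  simp only [Complex.inner, map_mul, mul_re, mul_im, conj_re, conj_im]
  linear_combination (x.re * y.re + x.im * y.im) * hz'

theorem isPrincipalFamily_ofComplexPair (θ : Fin 2 → ℝ) {z w : ℂ} (hz : ‖z‖ = 1) (hw : ‖w‖ = 1) :
    IsPrincipalFamily firstComplexLine θ fun i => ofComplexPair
      (z * (Real.cos (θ i) * I ^ (i : ℕ)), w * (Real.sin (θ i) * I ^ (i : ℕ))) := by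
  refine ⟨orthonormal_iff_ite.2 fun i j => ?_, fun i => ?_, fun {i j} hij => ?_⟩
  · rw [inner_ofComplexPair, inner_mul_mul_of_norm_eq_one hz, inner_mul_mul_of_norm_eq_one hw]
    fin_cases i <;> fin_cases j <;>
      simp [Complex.inner, -ofReal_cos, -ofReal_sin, ← sq]
  · rw [starProjection_firstComplexLine, inner_ofComplexPair, inner_mul_mul_of_norm_eq_one hz]
    fin_cases i <;> simp [sq, -ofReal_cos]
  · rw [starProjection_firstComplexLine, starProjection_firstComplexLine, inner_ofComplexPair,
      inner_mul_mul_of_norm_eq_one hz]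
    fin_cases i <;> fin_cases j <;> simp_all

end ComplexCoordinates

section SpiralSurface

open Complex

/-- The exponent `(a₀ + i a₁)(b₀ x + i b₁ y)` of the spirals that make up `spiralSurface`. -/
def spiralExponent (a b : Fin 2 → ℝ) : EuclideanSpace ℝ (Fin 2) →L[ℝ] ℂ :=
  ∑ i, (EuclideanSpace.proj i : EuclideanSpace ℝ (Fin 2) →L[ℝ] ℝ).smulRight
    ((a 0 + a 1 * I) * (b i * I ^ (i : ℕ)))

variable (a b : Fin 2 → ℝ) (q : EuclideanSpace ℝ (Fin 2))

theorem spiralExponent_single (i : Fin 2) :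
    spiralExponent a b (EuclideanSpace.single i 1) = (a 0 + a 1 * I) * (b i * I ^ (i : ℕ)) := by
  fin_cases i <;> simp [spiralExponent]

theorem re_spiralExponent_comm : (spiralExponent a b q).re = (spiralExponent b a q).re := by
  simp [spiralExponent, mul_comm]

theorem im_spiralExponent_single {i j : Fin 2} (hij : i ≠ j) :
    (spiralExponent a b (EuclideanSpace.single i 1)).im = a j * b i := by
  rw [spiralExponent_single]
  obtain ⟨rfl, rfl⟩ | ⟨rfl, rfl⟩ : i = 0 ∧ j = 1 ∨ i = 1 ∧ j = 0 := by omega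
  all_goals simp

theorem exp_spiralExponent : cexp (spiralExponent a b q) =
    Real.exp (spiralExponent a b q).re * cexp ((spiralExponent a b q).im * I) := by
  rw [ofReal_exp, ← Complex.exp_add, re_add_im]

/-- The map `q ↦ exp(μ q) / (a₀ + i a₁)` with exponent `μ = spiralExponent a b`. The factor
`1 / (a₀ + i a₁)` makes the derivative `exp(μ q)` times `(x, y) ↦ b₀ x + i b₁ y`. -/
def spiral (q : EuclideanSpace ℝ (Fin 2)) : ℂ :=
  cexp (spiralExponent a b q) / (a 0 + a 1 * I)

theorem contDiff_spiral {n : WithTop ℕ∞} : ContDiff ℝ n (spiral a b) :=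
  ((spiralExponent a b).contDiff.cexp).div_const _

variable {a} in
theorem fderiv_spiral_single (ha : a 0 ≠ 0) (i : Fin 2) :
    fderiv ℝ (spiral a b) q (EuclideanSpace.single i 1) =
      cexp (spiralExponent a b q) * (b i * I ^ (i : ℕ)) := by
  have ha' : (a 0 + a 1 * I : ℂ) ≠ 0 := fun h => ha (by simpa using congrArg re h)
  have h := ((spiralExponent a b).hasFDerivAt (x := q)).cexp.mul_const (a 0 + a 1 * I : ℂ)⁻¹
  have h' : HasFDerivAt (spiral a b) _ q := h
  rw [h'.fderiv]
  simp only [smul_apply, spiralExponent_single, smul_eq_mul]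
  field_simp

/-- The unit complex number `exp(i Im(μ q))` with exponent `μ = spiralExponent a b`. -/
def spiralPhase (q : EuclideanSpace ℝ (Fin 2)) : ℂ := cexp ((spiralExponent a b q).im * I)

theorem norm_spiralPhase : ‖spiralPhase a b q‖ = 1 := norm_exp_ofReal_mul_I _

theorem contDiff_spiralPhase {n : WithTop ℕ∞} : ContDiff ℝ n (spiralPhase a b) :=
  (((ofRealCLM ∘L imCLM ∘L spiralExponent a b).contDiff).mul contDiff_const).cexp

theorem fderiv_spiralPhase_apply (t : EuclideanSpace ℝ (Fin 2)) :
    fderiv ℝ (spiralPhase a b) q t = spiralPhase a b q * ((spiralExponent a b t).im * I) := by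
  have h : HasFDerivAt (spiralPhase a b) _ q :=
    (((ofRealCLM ∘L imCLM ∘L spiralExponent a b).hasFDerivAt (x := q)).mul_const I).cexp
  rw [h.fderiv]
  simp [spiralPhase, mul_comm I]

/-- The surface `(exp(μ) / (s₀ + i s₁), exp(μ') / (c₀ + i c₁))` in `ℂ × ℂ = ℝ⁴`, with `sᵢ = sin θᵢ`,
`cᵢ = cos θᵢ`, `μ = (s₀ + i s₁)(c₀ x + i c₁ y)` and `μ' = (c₀ + i c₁)(s₀ x + i s₁ y)`. The exponents
are chosen to have the same real part, so the partial derivatives are the fields `spiralField` up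
to a common factor. -/
def spiralSurface (θ : Fin 2 → ℝ) (q : EuclideanSpace ℝ (Fin 2)) : EuclideanSpace ℝ (Fin 4) :=
  ofComplexPair (spiral (Real.sin ∘ θ) (Real.cos ∘ θ) q,
    spiral (Real.cos ∘ θ) (Real.sin ∘ θ) q)

/-- The principal fields of `spiralSurface` relative to `firstComplexLine`. -/
def spiralField (θ : Fin 2 → ℝ) (i : Fin 2) (q : EuclideanSpace ℝ (Fin 2)) :
    EuclideanSpace ℝ (Fin 4) :=
  ofComplexPair
    (spiralPhase (Real.sin ∘ θ) (Real.cos ∘ θ) q *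
        (Real.cos (θ i) * I ^ (i : ℕ)),
      spiralPhase (Real.cos ∘ θ) (Real.sin ∘ θ) q *
        (Real.sin (θ i) * I ^ (i : ℕ)))

variable (θ : Fin 2 → ℝ)

theorem contDiff_spiralSurface {n : WithTop ℕ∞} : ContDiff ℝ n (spiralSurface θ) :=
  ofComplexPair.contDiff.comp ((contDiff_spiral _ _).prodMk (contDiff_spiral _ _))

theorem contDiff_spiralField (i : Fin 2) {n : WithTop ℕ∞} : ContDiff ℝ n (spiralField θ i) :=
  ofComplexPair.contDiff.comp (((contDiff_spiralPhase _ _).mul contDiff_const).prodMk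
    ((contDiff_spiralPhase _ _).mul contDiff_const))

theorem connectionForm_spiralField (i j : Fin 2) (t : EuclideanSpace ℝ (Fin 2)) :
    connectionForm firstComplexLine (spiralField θ) i j q t =
      (spiralExponent (Real.sin ∘ θ) (Real.cos ∘ θ) t).im *
        (Real.cos (θ i) * Real.cos (θ j) * ⟪I * I ^ (i : ℕ), I ^ (j : ℕ)⟫) := by
  have h₁ := (contDiff_spiralPhase (n := 1) (Real.sin ∘ θ) (Real.cos ∘ θ)).differentiable
    one_ne_zero q
  have h₂ := (contDiff_spiralPhase (n := 1) (Real.cos ∘ θ) (Real.sin ∘ θ)).differentiable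
    one_ne_zero q
  have h : HasFDerivAt (spiralField θ i) _ q := ofComplexPair.hasFDerivAt.comp q
    ((h₁.hasFDerivAt.mul_const (Real.cos (θ i) * I ^ (i : ℕ) : ℂ)).prodMk
      (h₂.hasFDerivAt.mul_const (Real.sin (θ i) * I ^ (i : ℕ) : ℂ)))
  have hfderiv : (Real.cos (θ i) * I ^ (i : ℕ) : ℂ) *
      fderiv ℝ (spiralPhase (Real.sin ∘ θ) (Real.cos ∘ θ)) q t =
      spiralPhase (Real.sin ∘ θ) (Real.cos ∘ θ) q *
        (((spiralExponent (Real.sin ∘ θ) (Real.cos ∘ θ) t).im * Real.cos (θ i)) •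
          (I * I ^ (i : ℕ))) := by
    rw [fderiv_spiralPhase_apply, real_smul]
    push_cast
    ring
  rw [connectionForm, h.fderiv, spiralField, ContinuousLinearMap.comp_apply,
    starProjection_firstComplexLine, starProjection_firstComplexLine, inner_ofComplexPair,
    inner_zero_left, add_zero, ContinuousLinearMap.prod_apply, smul_apply, smul_eq_mul, hfderiv,
    inner_mul_mul_of_norm_eq_one (norm_spiralPhase _ _ _), ← real_smul, real_inner_smul_left,
    real_inner_smul_right]
  ring

variable {θ} (hθ : ∀ i, Real.tan (θ i) ≠ 0)
include hθ

theorem fderiv_spiralSurface_single (i : Fin 2) :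
    fderiv ℝ (spiralSurface θ) q (EuclideanSpace.single i 1) =
      Real.exp (spiralExponent (Real.sin ∘ θ) (Real.cos ∘ θ) q).re •
        spiralField θ i q := by
  obtain ⟨hsin, hcos⟩ := div_ne_zero_iff.1 (Real.tan_eq_sin_div_cos (θ 0) ▸ hθ 0)
  have h₁ := (contDiff_spiral (n := 1) (Real.sin ∘ θ) (Real.cos ∘ θ)).differentiable one_ne_zero q
  have h₂ := (contDiff_spiral (n := 1) (Real.cos ∘ θ) (Real.sin ∘ θ)).differentiable one_ne_zero q
  have h := ofComplexPair.hasFDerivAt.comp q (h₁.hasFDerivAt.prodMk h₂.hasFDerivAt)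
  have h' : HasFDerivAt (spiralSurface θ) _ q := h
  rw [h'.fderiv, spiralField, ← map_smul]
  simp only [ContinuousLinearMap.comp_apply, ContinuousLinearMap.prod_apply, Prod.smul_mk]
  rw [fderiv_spiral_single _ _ hsin, fderiv_spiral_single _ _ hcos, exp_spiralExponent,
    exp_spiralExponent, re_spiralExponent_comm (Real.cos ∘ θ), spiralPhase, spiralPhase,
    real_smul, real_smul, mul_assoc, mul_assoc, Function.comp_apply, Function.comp_apply]

theorem exists_fderiv_spiralSurface_eq (i : Fin 2) : ∃ r : ℝ, r ≠ 0 ∧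
    fderiv ℝ (spiralSurface θ) q (r • EuclideanSpace.single i 1) = spiralField θ i q := by
  refine ⟨(Real.exp (spiralExponent (Real.sin ∘ θ) (Real.cos ∘ θ) q).re)⁻¹,
    inv_ne_zero (Real.exp_ne_zero _), ?_⟩
  rw [map_smul, fderiv_spiralSurface_single q hθ, inv_smul_smul₀ (Real.exp_ne_zero _)]

theorem isPrincipalFrame_spiralField :
    IsPrincipalFrame Set.univ (spiralSurface θ) firstComplexLine θ (spiralField θ) where
  card_eq_finrank := by simp
  isOpen := isOpen_univ
  contDiffOn := (contDiff_spiralSurface θ).contDiffOn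
  contDiffOn_field i := (contDiff_spiralField θ i).contDiffOn
  mem_range {q} _ i := by
    obtain ⟨r, -, hr⟩ := exists_fderiv_spiralSurface_eq q hθ i
    exact ⟨_, hr⟩
  isPrincipalFamily _ := isPrincipalFamily_ofComplexPair θ (norm_spiralPhase _ _ _)
    (norm_spiralPhase _ _ _)

theorem finrank_firstNormalSpace_spiralSurface (hne : Real.tan (θ 0) ^ 2 ≠ Real.tan (θ 1) ^ 2) :
    Module.finrank ℝ (firstNormalSpace (spiralSurface θ) q) = 2 := by
  choose r hr0 hr using exists_fderiv_spiralSurface_eq q hθ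
  refine ((isPrincipalFrame_spiralField hθ).finrank_firstNormalSpace_eq_two_iff hθ
    (Set.mem_univ q) hr hne).2 fun i j hij => ?_
  have hsin_cos (i : Fin 2) : Real.sin (θ i) ≠ 0 ∧ Real.cos (θ i) ≠ 0 :=
    div_ne_zero_iff.1 (Real.tan_eq_sin_div_cos (θ i) ▸ hθ i)
  have hI : ⟪I * I ^ (i : ℕ), I ^ (j : ℕ)⟫ ≠ 0 := by
    obtain ⟨rfl, rfl⟩ | ⟨rfl, rfl⟩ : i = 0 ∧ j = 1 ∨ i = 1 ∧ j = 0 := by omega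
    all_goals simp
  rw [connectionForm_spiralField, map_smul, smul_im, im_spiralExponent_single _ _ hij]
  simp [hr0 i, hsin_cos, hI, -Complex.inner]

theorem exists_isEmbedding_spiralSurface :
    ∃ U, IsImmersedSurface U (spiralSurface θ) ∧
      Topology.IsEmbedding (U.domRestrict (spiralSurface θ)) := by
  have hinj (q : EuclideanSpace ℝ (Fin 2)) : Function.Injective (fderiv ℝ (spiralSurface θ) q) :=
    (isPrincipalFrame_spiralField hθ).injective_fderiv (Set.mem_univ q)
  obtain ⟨U, hU, h0U, hembedding⟩ := exists_isEmbedding_of_hasStrictFDerivAt_injective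
    ((contDiff_spiralSurface (n := 1) θ).contDiffAt.hasStrictFDerivAt one_ne_zero) (hinj 0)
  exact ⟨U, ⟨hU, ⟨0, h0U⟩, (contDiff_spiralSurface θ).contDiffOn, fun p _ => hinj p⟩, hembedding⟩

end SpiralSurface

section OrderedAngles

variable {θ : Fin 2 → ℝ} (h0 : 0 < θ 0) (h01 : θ 0 < θ 1) (hpi : θ 1 < Real.pi / 2)
include h0 h01 hpi

theorem tan_ne_zero_of_lt (i : Fin 2) : Real.tan (θ i) ≠ 0 := by
  revert i
  refine Fin.forall_fin_two.2 ⟨?_, ?_⟩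
  · exact (Real.tan_pos_of_pos_of_lt_pi_div_two h0 (h01.trans hpi)).ne'
  · exact (Real.tan_pos_of_pos_of_lt_pi_div_two (h0.trans h01) hpi).ne'

theorem tan_sq_ne_tan_sq_of_lt : Real.tan (θ 0) ^ 2 ≠ Real.tan (θ 1) ^ 2 :=
  (pow_lt_pow_left₀ (Real.tan_lt_tan_of_nonneg_of_lt_pi_div_two h0.le hpi h01)
    (Real.tan_pos_of_pos_of_lt_pi_div_two h0 (h01.trans hpi)).le two_ne_zero).ne

theorem hasConstantPrincipalAngles_spiralSurface (U : Set (EuclideanSpace ℝ (Fin 2))) :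
    HasConstantPrincipalAngles U (spiralSurface θ) firstComplexLine (θ 0) (θ 1) := by
  have h := isPrincipalFrame_spiralField (tan_ne_zero_of_lt h0 h01 hpi)
  refine ⟨finrank_firstComplexLine, fun p _ => ?_⟩
  exact (h.isPrincipalFamily (Set.mem_univ p)).isPrincipalAngles (h.mem_range (Set.mem_univ p))
    (h.finrank_range (Set.mem_univ p)) h0.le h01.le hpi

end OrderedAngles

end

theorem mainTheorem10 :
    (∀ θ₁ θ₂ : ℝ, 0 < θ₁ → θ₁ < θ₂ → θ₂ < Real.pi / 2 →
      ∃ (P : Submodule ℝ (EuclideanSpace ℝ (Fin 4))) (U : Set (EuclideanSpace ℝ (Fin 2)))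
        (X : EuclideanSpace ℝ (Fin 2) → EuclideanSpace ℝ (Fin 4)),
        IsImmersedSurface U X ∧ Topology.IsEmbedding (U.domRestrict X) ∧
        HasConstantPrincipalAngles U X P θ₁ θ₂ ∧
        ∀ p ∈ U, Module.finrank ℝ (firstNormalSpace X p) = 2) ∧
    (∀ θ₁ θ₂ : ℝ, 0 < θ₁ → θ₁ < θ₂ → θ₂ < Real.pi / 2 →
      ∀ (P : Submodule ℝ (EuclideanSpace ℝ (Fin 4))) (U : Set (EuclideanSpace ℝ (Fin 2)))
        (X : EuclideanSpace ℝ (Fin 2) → EuclideanSpace ℝ (Fin 4)),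
        IsImmersedSurface U X →
        HasConstantPrincipalAngles U X P θ₁ θ₂ →
        (∀ p ∈ U, Module.finrank ℝ (firstNormalSpace X p) = 2) →
        (∀ p ∈ U, ∃ V ⊆ U, IsOpen V ∧ p ∈ V ∧
          (∃ T₁, IsPrincipalField V X P θ₁ T₁) ∧ (∃ T₂, IsPrincipalField V X P θ₂ T₂)) ∧
        (∀ V ⊆ U, IsOpen V → V.Nonempty →
          (∀ T₁, IsPrincipalField V X P θ₁ T₁ → ¬ IsGeodesicField V X T₁) ∧
          (∀ T₂, IsPrincipalField V X P θ₂ T₂ → ¬ IsGeodesicField V X T₂)) ∧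
        (∀ V ⊆ U, IsOpen V → V.Nonempty → ¬ IsComposition V X)) := by
  refine ⟨fun θ₁ θ₂ h₁ h₁₂ h₂ => ?_, fun θ₁ θ₂ h₁ h₁₂ h₂ P U X hX hangles hfull => ?_⟩
  all_goals obtain ⟨θ, rfl, rfl⟩ : ∃ θ : Fin 2 → ℝ, θ 0 = θ₁ ∧ θ 1 = θ₂ := ⟨![θ₁, θ₂], rfl, rfl⟩
  all_goals have hθ := tan_ne_zero_of_lt h₁ h₁₂ h₂
  all_goals have hne := tan_sq_ne_tan_sq_of_lt h₁ h₁₂ h₂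
  · obtain ⟨U, hU, hembedding⟩ := exists_isEmbedding_spiralSurface hθ
    exact ⟨firstComplexLine, U, spiralSurface θ, hU, hembedding,
      hasConstantPrincipalAngles_spiralSurface h₁ h₁₂ h₂ U,
      fun p _ => finrank_firstNormalSpace_spiralSurface p hθ hne⟩
  · refine ⟨fun p hp => ?_, fun V hVU hV hVne => ?_, fun V hVU hV hVne => ?_⟩
    · obtain ⟨V, hVU, hV, hpV, T, hT⟩ :=
        exists_forall_isPrincipalField hX hangles (cos_sq_ne_of_tan_sq_ne hne) hp
      exact ⟨V, hVU, hV, hpV, ⟨T 0, hT 0⟩, ⟨T 1, hT 1⟩⟩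
    · have hgeodesic {i : Fin 2} {T : EuclideanSpace ℝ (Fin 2) → EuclideanSpace ℝ (Fin 4)}
          (hT : IsPrincipalField V X P (θ i) T) : ¬ IsGeodesicField V X T :=
        hT.not_isGeodesicField (hX.mono hVU hV hVne) (hangles.mono hVU) hθ hne
          fun q hq => hfull q (hVU hq)
      exact ⟨fun _ => hgeodesic, fun _ => hgeodesic⟩
    · exact (hX.mono hVU hV hVne).not_isComposition (hangles.mono hVU) hθ hne
        fun q hq => hfull q (hVU hq)
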